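/- Let $(M,g)$ be a smooth four-dimensional Lorentzian manifold of signature $(-,+,+,+)$, with Levi-Civita connection $\nabla$, Ricci tensor $R_{ab}=R^c{}_{acb}$, Ricci scalar $R$ and Weyl tensor $C_{abcd}$. Let $\alpha',\beta',\gamma',\Lambda$ be real constants such that $\alpha'$ and $\gamma'+8\beta'\Lambda$ are not both zero (for example, $\alpha'\neq 0$). Suppose that $g$ satisfies the vacuum field equations of quadratic gravity $$\gamma'\left(R_{ab}-\tfrac12 R g_{ab}+\Lambda g_{ab}\right)-4\alpha' B_{ab}+2\beta'\left(R_{ab}-\tfrac14 R g_{ab}+g_{ab}\Box-\nabla_b\nabla_a\right)R=0,$$ where $\Box=g^{ab}\nabla_a\nabla_b$ and $B_{ab}=\left(\nabla^c\nabla^d+\tfrac12R^{cd}\right)C_{acbd}$ is the Bach tensor. Suppose also that there are a smooth nowhere vanishing null vector field $\ell$ and a nowhere vanishing function $\omega'$ on $M$ such that $$R_{ab}=\Lambda g_{ab}+\omega'\,\ell_a\ell_b$$ (in particular $R=4\Lambda$ is constant), and that the Weyl tensor is aligned with $\ell$: for every real null frame $(\ell,n,m^{(2)},m^{(3)})$,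 with $\ell^a\ell_a=n^an_a=0$, $\ell^an_a=1$, $m^{(i)a}m^{(j)}_a=\delta_{ij}$, $\ell^am^{(i)}_a=n^am^{(i)}_a=0$, all frame components of $C_{abcd}$ of boost weight greater than $1$ vanish, where the boost weight of a component is the number of contractions with $\ell$ minus the number of contractions with $n$. The Petrov type is otherwise arbitrary. Then $\ell$ is geodetic, i.e. $\ell^b\nabla_b\ell_a$ is proportional to $\ell_a$ at every point, and its optical matrix $\rho_{ij}=(\nabla_b\ell_a)\,m^{(i)a}m^{(j)b}$, $i,j=2,3$, vanishes in every such null frame. Consequently $(M,g)$ is a Kundt spacetime, i.e. it admits a smooth nowhere vanishing null vector field that is geodetic and has vanishing optical matrix. -/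

import Mathlib

open scoped Manifold ContDiff Bundle

noncomputable section

namespace QuadraticGravity

/-- The model space of four-dimensional spacetimes. -/
abbrev E4 : Type := EuclideanSpace ℝ (Fin 4)

/-! ### Tensor calculus in a coordinate chart

`G : E4 → Matrix (Fin 4) (Fin 4) ℝ` is the matrix of metric components `g_{ab}` as a function of the
coordinates. -/

/-- The partial derivative `∂_i f`. -/
def pd (i : Fin 4) (f : E4 → ℝ) (y : E4) : ℝ :=
  fderiv ℝ f y (EuclideanSpace.single i 1)

/-- Components `T_{a₁ … a_k}` of a covariant tensor field of rank `k`, as functions of the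
coordinates. -/
abbrev TensorField (k : ℕ) : Type := (Fin k → Fin 4) → E4 → ℝ

/-- The metric components. -/
abbrev MetricField : Type := E4 → Matrix (Fin 4) (Fin 4) ℝ

/-- The inverse metric `g^{ab}`. -/
def ginv (G : MetricField) (a b : Fin 4) (y : E4) : ℝ := (G y)⁻¹ a b

/-- The Christoffel symbols `Γ^a_{bc}` of the Levi-Civita connection. -/
def christoffel (G : MetricField) (a b c : Fin 4) (y : E4) : ℝ :=
  (1 / 2 : ℝ) * ∑ d, ginv G a d y *
    (pd b (fun z => G z d c) y + pd c (fun z => G z d b) y - pd d (fun z => G z b c) y)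

/-- The covariant derivative; the derivative index comes first:
`covDeriv G T ![c, a₁, …, a_k] = ∇_c T_{a₁ … a_k}`. -/
def covDeriv (G : MetricField) {k : ℕ} (T : TensorField k) : TensorField (k + 1) :=
  fun I y => pd (I 0) (T (fun s => I s.succ)) y
    - ∑ s : Fin k, ∑ e : Fin 4,
        christoffel G e (I 0) (I s.succ) y * T (Function.update (fun s => I s.succ) s e) y

/-- The curvature tensor
`R^a_{bcd} = ∂_c Γ^a_{db} - ∂_d Γ^a_{cb} + Γ^a_{ce} Γ^e_{db} - Γ^a_{de} Γ^e_{cb}`. -/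
def riemannUp (G : MetricField) (a b c d : Fin 4) (y : E4) : ℝ :=
  pd c (christoffel G a d b) y - pd d (christoffel G a c b) y
    + ∑ e, (christoffel G a c e y * christoffel G e d b y
      - christoffel G a d e y * christoffel G e c b y)

/-- The Riemann tensor `R_{abcd}`. -/
def riemann (G : MetricField) (a b c d : Fin 4) (y : E4) : ℝ :=
  ∑ e, G y a e * riemannUp G e b c d y

/-- The Ricci tensor `R_{ab} = R^c_{acb}`. -/
def ricci (G : MetricField) (a b : Fin 4) (y : E4) : ℝ :=
  ∑ c, riemannUp G c a c b y

/-- The Ricci scalar `R = g^{ab} R_{ab}`. -/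
def scalarCurv (G : MetricField) (y : E4) : ℝ :=
  ∑ a, ∑ b, ginv G a b y * ricci G a b y

/-- The Weyl tensor `C_{abcd}` in dimension four. -/
def weyl (G : MetricField) : TensorField 4 := fun I y =>
  riemann G (I 0) (I 1) (I 2) (I 3) y
    - (1 / 2 : ℝ) * (G y (I 0) (I 2) * ricci G (I 1) (I 3) y
        - G y (I 0) (I 3) * ricci G (I 1) (I 2) y
        - G y (I 1) (I 2) * ricci G (I 0) (I 3) y
        + G y (I 1) (I 3) * ricci G (I 0) (I 2) y)
    + (1 / 6 : ℝ) * scalarCurv G y *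
        (G y (I 0) (I 2) * G y (I 1) (I 3) - G y (I 0) (I 3) * G y (I 1) (I 2))

/-- The Bach tensor `B_{ab} = (∇^c ∇^d + (1/2) R^{cd}) C_{acbd}`. -/
def bach (G : MetricField) (a b : Fin 4) (y : E4) : ℝ :=
  ∑ c, ∑ d, ∑ p, ∑ q, ginv G c p y * ginv G d q y *
    (covDeriv G (covDeriv G (weyl G)) ![p, q, a, c, b, d] y
      + (1 / 2 : ℝ) * ricci G p q y * weyl G ![a, c, b, d] y)

/-- The Hessian `∇_a ∇_b f` of a scalar. -/
def hess (G : MetricField) (f : E4 → ℝ) (a b : Fin 4) (y : E4) : ℝ :=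
  covDeriv G (covDeriv G (fun _ : Fin 0 → Fin 4 => f)) ![a, b] y

/-- The wave operator `□ f = g^{ab} ∇_a ∇_b f`. -/
def box (G : MetricField) (f : E4 → ℝ) (y : E4) : ℝ :=
  ∑ a, ∑ b, ginv G a b y * hess G f a b y

/-- The left-hand side of the vacuum field equations of quadratic gravity,
`γ' (R_{ab} - R g_{ab}/2 + Λ g_{ab}) - 4 α' B_{ab}
  + 2 β' (R_{ab} - R g_{ab}/4 + g_{ab} □ - ∇_b ∇_a) R`. -/
def fieldEq (α' β' γ' Λ : ℝ) (G : MetricField) (a b : Fin 4) (y : E4) : ℝ :=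
  γ' * (ricci G a b y - (1 / 2 : ℝ) * scalarCurv G y * G y a b + Λ * G y a b)
    - 4 * α' * bach G a b y
    + 2 * β' * ((ricci G a b y - (1 / 4 : ℝ) * scalarCurv G y * G y a b) * scalarCurv G y
        + G y a b * box G (scalarCurv G) y - hess G (scalarCurv G) b a y)

/-! ### Null frames and boost weights at a point of a chart -/

/-- The Gram matrix of a null frame `(ℓ, n, m⁽²⁾, m⁽³⁾)`. -/
def nullGram : Matrix (Fin 4) (Fin 4) ℝ :=
  !![0, 1, 0, 0; 1, 0, 0, 0; 0, 0, 1, 0; 0, 0, 0, 1]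

/-- `F = (ℓ, n, m⁽²⁾, m⁽³⁾)`, given by contravariant components `F i a`, is a real null frame:
`ℓ·ℓ = n·n = 0`, `ℓ·n = 1`, `m⁽ⁱ⁾·m⁽ʲ⁾ = δ_{ij}`, `ℓ·m⁽ⁱ⁾ = n·m⁽ⁱ⁾ = 0`. -/
def IsNullFrame (g : Matrix (Fin 4) (Fin 4) ℝ) (F : Fin 4 → Fin 4 → ℝ) : Prop :=
  ∀ i j, ∑ a, ∑ b, g a b * F i a * F j b = nullGram i j

/-- The frame component `T_{a₁ … a_k} F_{I₁}^{a₁} ⋯ F_{I_k}^{a_k}`. -/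
def frameComp {k : ℕ} (T : TensorField k) (F : Fin 4 → Fin 4 → ℝ) (y : E4)
    (I : Fin k → Fin 4) : ℝ :=
  ∑ J : Fin k → Fin 4, T J y * ∏ s, F (I s) (J s)

/-- The weight of a frame vector under the boost `ℓ ↦ λ ℓ`, `n ↦ λ⁻¹ n`, `m⁽ⁱ⁾ ↦ m⁽ⁱ⁾`. -/
def boostWeight : Fin 4 → ℤ := ![1, -1, 0, 0]

/-- All frame components of boost weight greater than `w` vanish. -/
def BoostOrderLE {k : ℕ} (T : TensorField k) (F : Fin 4 → Fin 4 → ℝ) (y : E4) (w : ℤ) : Prop :=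
  ∀ I : Fin k → Fin 4, w < ∑ s, boostWeight (I s) → frameComp T F y I = 0

/-- The covector components `ℓ_a = g_{ab} ℓ^b`. -/
def lower (G : MetricField) (l : E4 → Fin 4 → ℝ) : TensorField 1 :=
  fun I y => ∑ b, G y (I 0) b * l y b

/-- The optical matrix `ρ_{ij} = (∇_b ℓ_a) m⁽ⁱ⁾^a m⁽ʲ⁾^b`, `i, j = 2, 3`, in the frame `F`. -/
def opticalMatrix (G : MetricField) (l : E4 → Fin 4 → ℝ) (F : Fin 4 → Fin 4 → ℝ) (y : E4) :
    Matrix (Fin 2) (Fin 2) ℝ :=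
  fun i j => ∑ a, ∑ b, covDeriv G (lower G l) ![b, a] y * ![F 2, F 3] i a * ![F 2, F 3] j b

/-! ### Spacetimes -/

variable {M : Type*} [TopologicalSpace M] [ChartedSpace E4 M] [IsManifold (𝓡 4) ∞ M]

variable (M) in
/-- A smooth metric of signature `(-, +, +, +)` on the four-dimensional manifold `M`. -/
structure LorentzianMetric where
  /-- The scalar product on tangent spaces. -/
  inner (x : M) : TangentSpace (𝓡 4) x →L[ℝ] TangentSpace (𝓡 4) x →L[ℝ] ℝ
  symm (x : M) (v w : TangentSpace (𝓡 4) x) : inner x v w = inner x w v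
  signature (x : M) : ∃ b : Module.Basis (Fin 4) ℝ (TangentSpace (𝓡 4) x),
    ∀ i j, inner x (b i) (b j) = if i = j then (if i = 0 then -1 else 1) else 0
  contMDiff : ContMDiff (𝓡 4) ((𝓡 4).prod 𝓘(ℝ, E4 →L[ℝ] E4 →L[ℝ] ℝ)) ∞
    (fun x ↦ Bundle.TotalSpace.mk' (E4 →L[ℝ] E4 →L[ℝ] ℝ)
      (E := fun x : M ↦ TangentSpace (𝓡 4) x →L[ℝ] TangentSpace (𝓡 4) x →L[ℝ] ℝ) x (inner x))

/-- The coordinate vector `∂_i` of the chart `e` at the point with coordinates `y`. -/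
def coordVec (e : OpenPartialHomeomorph M E4) (y : E4) (i : Fin 4) :
    TangentSpace (𝓡 4) (e.symm y) :=
  mfderiv (𝓡 4) (𝓡 4) e.symm y (EuclideanSpace.single i (1 : ℝ) : E4)

/-- The components `g_{ij} = g(∂_i, ∂_j)` of the metric in the chart `e`. -/
def LorentzianMetric.comp (g : LorentzianMetric M) (e : OpenPartialHomeomorph M E4) :
    MetricField :=
  fun y => Matrix.of fun i j => g.inner (e.symm y) (coordVec e y i) (coordVec e y j)

/-- The components `ℓ^i = dy^i(ℓ)` of a vector field in the chart `e`. -/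
def vecComp (l : ∀ x : M, TangentSpace (𝓡 4) x) (e : OpenPartialHomeomorph M E4) :
    E4 → Fin 4 → ℝ :=
  fun y i => (show E4 from mfderiv (𝓡 4) (𝓡 4) e (e.symm y) (l (e.symm y))) i

/-- `ℓ` is a smooth, nowhere vanishing null vector field. -/
structure IsNullField (g : LorentzianMetric M) (l : ∀ x : M, TangentSpace (𝓡 4) x) : Prop where
  smooth : ContMDiff (𝓡 4) (𝓡 4).tangent ∞ (fun x => (⟨x, l x⟩ : TangentBundle (𝓡 4) M))
  ne_zero (x : M) : l x ≠ 0
  null (x : M) : g.inner x (l x) (l x) = 0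

/-- `g` solves the vacuum field equations of quadratic gravity. -/
def IsVacuumSolution (α' β' γ' Λ : ℝ) (g : LorentzianMetric M) : Prop :=
  ∀ e ∈ atlas E4 M, ∀ y ∈ e.target, ∀ a b, fieldEq α' β' γ' Λ (g.comp e) a b y = 0

/-- The Ricci tensor has the form `R_{ab} = Λ g_{ab} + ω' ℓ_a ℓ_b`. -/
def HasRicciForm (g : LorentzianMetric M) (l : ∀ x : M, TangentSpace (𝓡 4) x)
    (Λ : ℝ) (ω' : M → ℝ) : Prop :=
  ∀ e ∈ atlas E4 M, ∀ y ∈ e.target, ∀ a b,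
    ricci (g.comp e) a b y = Λ * g.comp e y a b
      + ω' (e.symm y) * lower (g.comp e) (vecComp l e) ![a] y
        * lower (g.comp e) (vecComp l e) ![b] y

/-- The Weyl tensor is aligned with `ℓ`: its boost order with respect to `ℓ` is at most `1`. -/
def IsWeylAligned (g : LorentzianMetric M) (l : ∀ x : M, TangentSpace (𝓡 4) x) : Prop :=
  ∀ e ∈ atlas E4 M, ∀ y ∈ e.target, ∀ F : Fin 4 → Fin 4 → ℝ,
    IsNullFrame (g.comp e y) F → F 0 = vecComp l e y →
      BoostOrderLE (weyl (g.comp e)) F y 1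

/-- `ℓ` is geodetic: `ℓ^b ∇_b ℓ_a` is proportional to `ℓ_a` at every point. -/
def IsGeodetic (g : LorentzianMetric M) (l : ∀ x : M, TangentSpace (𝓡 4) x) : Prop :=
  ∀ e ∈ atlas E4 M, ∀ y ∈ e.target, ∃ c : ℝ, ∀ a,
    ∑ b, vecComp l e y b * covDeriv (g.comp e) (lower (g.comp e) (vecComp l e)) ![b, a] y
      = c * lower (g.comp e) (vecComp l e) ![a] y

/-- The optical matrix of `ℓ` vanishes, in every null frame that contains `ℓ`. -/
def HasZeroOpticalMatrix (g : LorentzianMetric M) (l : ∀ x : M, TangentSpace (𝓡 4) x) : Prop :=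
  ∀ e ∈ atlas E4 M, ∀ y ∈ e.target, ∀ F : Fin 4 → Fin 4 → ℝ,
    IsNullFrame (g.comp e y) F → F 0 = vecComp l e y →
      opticalMatrix (g.comp e) (vecComp l e) F y = 0

/-- A Kundt spacetime admits a geodetic null congruence with vanishing optical matrix
(nonexpanding, shearfree and twistfree). -/
def IsKundt (g : LorentzianMetric M) : Prop :=
  ∃ k : ∀ x : M, TangentSpace (𝓡 4) x,
    IsNullField g k ∧ IsGeodetic g k ∧ HasZeroOpticalMatrix g k

end QuadraticGravity

end

/-!
# Quadratic gravity with null radiation Ricci tensor is Kundt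

Write `S = Ric - Λ g = ω ℓ ⊗ ℓ`. The trace of `S` vanishes, so the scalar curvature is the constant
`4 Λ`, and the twice contracted Bianchi identity gives `∇^b S_{ab} = 0`. Expanding the divergence of
`ω ℓ_a ℓ_b` shows that `ℓ^b ∇_b ℓ_a` is proportional to `ℓ_a`: the field `ℓ` is geodetic
(`HasNullRicciOn.geodetic`).

For the optical matrix, let `m` be one of the two transverse frame vectors and take the `mm`-component
of the field equations. The Ricci terms are multiples of `ℓ_a ℓ_b`, and `ℓ_a m^a = 0`, so only the
Bach tensor remains. By the contracted Bianchi identity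
`∇^d C_{acbd} = (∇_c S_{ba} - ∇_a S_{bc}) / 2` (`IsMetricOn.div_weyl`), hence
`2 B_{ab} = ∇^c ∇_c S_{ab} - ∇^c ∇_a S_{bc} + R^{cd} C_{acbd}`. The last two terms have no
`mm`-component: up to a multiple of `ℓ_b`, the Ricci identity and `∇^c S_{bc} = 0` turn the second one
into a curvature term with `mm`-component `ω R(ℓ, m, ℓ, m) = ω C(ℓ, m, ℓ, m)`; the third one contributes
`ω C(m, ℓ, m, ℓ)`, because the Weyl tensor is trace-free; and alignment kills these components, whose
boost weight is `2`. In the first term both factors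
`ℓ` have to be differentiated, so that (`HasNullRicciOn.transverse_bach`)
`B(m, m) = ω g^{cp} X_c X_p` with `X_c = m^b ∇_c ℓ_b`.
As `ℓ` is geodetic, `X` annihilates `ℓ`, and in the null frame `g^{cp} X_c X_p` is the sum of the
squares `X(m⁽²⁾)² + X(m⁽³⁾)²`. These are squares of entries of the optical matrix. The field equations
make the sum vanish when `α' ≠ 0`; for `α' = 0` they would force `ω = 0`
(`HasNullRicciOn.optical_eq_zero`).

Everything is computed in the components of one chart. Since only covariant components of tensor fields
are available, indices are raised by explicit contraction with `g^{ab}`, which commutes with the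
covariant derivative.
-/

noncomputable section

namespace QuadraticGravity

/-! ### Partial derivatives and Christoffel symbols -/

section PartialDerivatives

variable {U : Set E4} {f g : E4 → ℝ} {y : E4}

lemma differentiableAt_of_contDiffOn (hU : IsOpen U) (hf : ContDiffOn ℝ ∞ f U) (hy : y ∈ U) :
    DifferentiableAt ℝ f y :=
  (hf.contDiffAt (hU.mem_nhds hy)).differentiableAt (by simp)

lemma contDiffOn_pd (hU : IsOpen U) (hf : ContDiffOn ℝ ∞ f U) (c : Fin 4) :
    ContDiffOn ℝ ∞ (pd c f) U :=
  (hf.fderiv_of_isOpen hU (m := ∞) (by simp)).clm_apply contDiffOn_const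

lemma pd_congr (hU : IsOpen U) (h : ∀ z ∈ U, f z = g z) (hy : y ∈ U) (c : Fin 4) :
    pd c f y = pd c g y := by
  unfold pd
  rw [Filter.EventuallyEq.fderiv_eq (Filter.eventuallyEq_of_mem (hU.mem_nhds hy) h)]

lemma pd_const (c : Fin 4) (r : ℝ) : pd c (fun _ => r) y = 0 := by
  simp [pd]

lemma pd_add (hU : IsOpen U) (hf : ContDiffOn ℝ ∞ f U) (hg : ContDiffOn ℝ ∞ g U) (hy : y ∈ U)
    (c : Fin 4) : pd c (fun z => f z + g z) y = pd c f y + pd c g y := by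
  unfold pd
  rw [fderiv_fun_add (differentiableAt_of_contDiffOn hU hf hy)
    (differentiableAt_of_contDiffOn hU hg hy)]
  rfl

lemma pd_sub (hU : IsOpen U) (hf : ContDiffOn ℝ ∞ f U) (hg : ContDiffOn ℝ ∞ g U) (hy : y ∈ U)
    (c : Fin 4) : pd c (fun z => f z - g z) y = pd c f y - pd c g y := by
  unfold pd
  rw [fderiv_fun_sub (differentiableAt_of_contDiffOn hU hf hy)
    (differentiableAt_of_contDiffOn hU hg hy)]
  rfl

lemma pd_mul (hU : IsOpen U) (hf : ContDiffOn ℝ ∞ f U) (hg : ContDiffOn ℝ ∞ g U) (hy : y ∈ U)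
    (c : Fin 4) : pd c (fun z => f z * g z) y = pd c f y * g y + f y * pd c g y := by
  unfold pd
  rw [fderiv_fun_mul (differentiableAt_of_contDiffOn hU hf hy)
    (differentiableAt_of_contDiffOn hU hg hy)]
  simp
  ring

lemma pd_sum {ι : Type*} [Fintype ι] {F : ι → E4 → ℝ} (hU : IsOpen U)
    (hF : ∀ i, ContDiffOn ℝ ∞ (F i) U) (hy : y ∈ U) (c : Fin 4) :
    pd c (fun z => ∑ i, F i z) y = ∑ i, pd c (F i) y := by
  unfold pd
  rw [fderiv_fun_sum fun i _ => differentiableAt_of_contDiffOn hU (hF i) hy]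
  simp

lemma contDiffOn_sum {ι : Type*} [Fintype ι] {F : ι → E4 → ℝ}
    (hF : ∀ i, ContDiffOn ℝ ∞ (F i) U) : ContDiffOn ℝ ∞ (fun z => ∑ i, F i z) U :=
  ContDiffOn.sum fun i _ => hF i

lemma pd_comm (hU : IsOpen U) (hf : ContDiffOn ℝ ∞ f U) (hy : y ∈ U) (a b : Fin 4) :
    pd a (pd b f) y = pd b (pd a f) y := by
  have h1 : ContDiffAt ℝ ∞ f y := hf.contDiffAt (hU.mem_nhds hy)
  have h2 : DifferentiableAt ℝ (fderiv ℝ f) y :=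
    ((hf.fderiv_of_isOpen hU (m := ∞) (by simp)).contDiffAt (hU.mem_nhds hy)).differentiableAt
      (by simp)
  have h3 : IsSymmSndFDerivAt ℝ f y := h1.isSymmSndFDerivAt (by
    simpa using (WithTop.coe_le_coe.mpr le_top : ((2 : ℕ∞) : WithTop ℕ∞) ≤ ∞))
  have key : ∀ v w : E4, fderiv ℝ (fun z => fderiv ℝ f z v) y w
      = fderiv ℝ (fderiv ℝ f) y w v := by
    intro v w
    rw [fderiv_clm_apply h2 (differentiableAt_const v)]
    simp
  unfold pd
  rw [key, key]
  exact h3 _ _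

end PartialDerivatives

lemma sum_mul_sum_assoc {ι κ : Type*} [Fintype ι] [Fintype κ] (X : ι → ℝ) (A : ι → κ → ℝ)
    (B : κ → ℝ) : ∑ d, (∑ f, X f * A f d) * B d = ∑ f, X f * ∑ d, A f d * B d := by
  simp only [Finset.mul_sum, Finset.sum_mul, mul_assoc]
  rw [Finset.sum_comm]

/-- `G` is a smooth nondegenerate symmetric metric on the open set `U` of coordinates. -/
structure IsMetricOn (U : Set E4) (G : MetricField) : Prop where
  isOpen : IsOpen U
  contDiffOn (a b : Fin 4) : ContDiffOn ℝ ∞ (fun z => G z a b) U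
  symm (y : E4) (hy : y ∈ U) (a b : Fin 4) : G y a b = G y b a
  det_ne (y : E4) (hy : y ∈ U) : (G y).det ≠ 0

namespace IsMetricOn

variable {U : Set E4} {G : MetricField} {y : E4} (hG : IsMetricOn U G)
include hG

lemma sum_mul_ginv (hy : y ∈ U) (a b : Fin 4) :
    ∑ e, G y a e * ginv G e b y = if a = b then 1 else 0 := by
  have h := Matrix.mul_nonsing_inv (G y) (isUnit_iff_ne_zero.mpr (hG.det_ne y hy))
  simpa [ginv, Matrix.mul_apply, Matrix.one_apply] using congrFun (congrFun h a) b

lemma sum_ginv_mul (hy : y ∈ U) (a b : Fin 4) :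
    ∑ e, ginv G a e y * G y e b = if a = b then 1 else 0 := by
  have h := Matrix.nonsing_inv_mul (G y) (isUnit_iff_ne_zero.mpr (hG.det_ne y hy))
  simpa [ginv, Matrix.mul_apply, Matrix.one_apply] using congrFun (congrFun h a) b

lemma ginv_symm (hy : y ∈ U) (a b : Fin 4) : ginv G a b y = ginv G b a y := by
  have h : (G y).IsSymm := Matrix.IsSymm.ext fun i j => hG.symm y hy j i
  unfold ginv
  have h2 : ((G y)⁻¹).transpose = (G y)⁻¹ := by rw [Matrix.transpose_nonsing_inv, h.eq]
  exact (congrFun (congrFun h2 a) b).symm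

lemma contDiffOn_ginv (a b : Fin 4) : ContDiffOn ℝ ∞ (ginv G a b) U := by
  have hdet : ContDiffOn ℝ ∞ (fun z => (G z).det) U := by
    simp only [Matrix.det_apply]
    refine ContDiffOn.sum fun σ _ => ContDiffOn.const_smul _ ?_
    exact contDiffOn_prod fun i _ => hG.contDiffOn _ _
  have hadj : ContDiffOn ℝ ∞ (fun z => (G z).adjugate a b) U := by
    simp only [Matrix.adjugate_apply, Matrix.det_apply]
    refine ContDiffOn.sum fun σ _ => ContDiffOn.const_smul _ ?_
    refine contDiffOn_prod fun i _ => ?_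
    by_cases h : σ i = b
    · simp only [Matrix.updateRow_apply, h, if_true]
      exact contDiffOn_const
    · simp only [Matrix.updateRow_apply, h, if_false]
      exact hG.contDiffOn _ _
  refine ((hdet.inv hG.det_ne).mul hadj).congr fun z hz => ?_
  simp [ginv, Matrix.inv_def]

lemma contDiffOn_christoffel (a b c : Fin 4) : ContDiffOn ℝ ∞ (christoffel G a b c) U := by
  unfold christoffel
  refine contDiffOn_const.mul (contDiffOn_sum fun d => (hG.contDiffOn_ginv _ _).mul ?_)
  exact ((contDiffOn_pd hG.isOpen (hG.contDiffOn _ _) _).add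
    (contDiffOn_pd hG.isOpen (hG.contDiffOn _ _) _)).sub
    (contDiffOn_pd hG.isOpen (hG.contDiffOn _ _) _)

lemma pd_metric_symm (hy : y ∈ U) (a b c : Fin 4) :
    pd c (fun z => G z a b) y = pd c (fun z => G z b a) y :=
  pd_congr hG.isOpen (fun z hz => hG.symm z hz a b) hy c

lemma christoffel_symm (hy : y ∈ U) (a b c : Fin 4) :
    christoffel G a b c y = christoffel G a c b y := by
  unfold christoffel
  congr 1
  refine Finset.sum_congr rfl fun d _ => ?_
  rw [hG.pd_metric_symm hy b c d]
  ring

/-- The Christoffel symbols with the upper index lowered. -/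
lemma sum_metric_mul_christoffel (hy : y ∈ U) (a b c : Fin 4) :
    ∑ e, G y a e * christoffel G e b c y = (1 / 2 : ℝ) *
      (pd b (fun z => G z a c) y + pd c (fun z => G z a b) y - pd a (fun z => G z b c) y) := by
  unfold christoffel
  set X : Fin 4 → ℝ := fun d =>
    pd b (fun z => G z d c) y + pd c (fun z => G z d b) y - pd d (fun z => G z b c) y
  calc ∑ e, G y a e * ((1 / 2 : ℝ) * ∑ d, ginv G e d y * X d)
      = (1 / 2 : ℝ) * ∑ d, (∑ e, G y a e * ginv G e d y) * X d := by
        simp only [Finset.mul_sum, Finset.sum_mul]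
        rw [Finset.sum_comm]
        refine Finset.sum_congr rfl fun d _ => Finset.sum_congr rfl fun e _ => ?_
        ring
    _ = _ := by
        simp only [hG.sum_mul_ginv hy]
        simp [X]

/-- The Levi-Civita connection is metric. -/
lemma pd_metric (hy : y ∈ U) (a b c : Fin 4) :
    pd c (fun z => G z a b) y = ∑ e, christoffel G e c a y * G y e b
      + ∑ e, christoffel G e c b y * G y a e := by
  have h1 := hG.sum_metric_mul_christoffel hy b c a
  have h2 := hG.sum_metric_mul_christoffel hy a c b
  have e1 : ∑ e, christoffel G e c a y * G y e b = ∑ e, G y b e * christoffel G e c a y :=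
    Finset.sum_congr rfl fun e _ => by rw [hG.symm y hy e b, mul_comm]
  have e2 : ∑ e, christoffel G e c b y * G y a e = ∑ e, G y a e * christoffel G e c b y :=
    Finset.sum_congr rfl fun e _ => by rw [mul_comm]
  rw [e1, e2, h1, h2, hG.pd_metric_symm hy b a c, hG.pd_metric_symm hy c a b,
    hG.pd_metric_symm hy c b a]
  ring

lemma pd_ginv (hy : y ∈ U) (a b c : Fin 4) :
    pd c (ginv G a b) y = - ∑ e, christoffel G a c e y * ginv G e b y
      - ∑ e, christoffel G b c e y * ginv G a e y := by
  have hU := hG.isOpen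
  -- Differentiate `G⁻¹ G = 1`.
  have key : ∀ d, ∑ e, (pd c (ginv G a e) y * G y e d
      + ginv G a e y * pd c (fun z => G z e d) y) = 0 := by
    intro d
    have h1 : pd c (fun z => ∑ e, ginv G a e z * G z e d) y = 0 := by
      rw [pd_congr hU (fun z hz => hG.sum_ginv_mul hz a d) hy c, pd_const]
    rw [pd_sum hU (fun e => (hG.contDiffOn_ginv a e).mul (hG.contDiffOn e d)) hy] at h1
    rw [← h1]
    refine Finset.sum_congr rfl fun e _ => ?_
    rw [pd_mul hU (hG.contDiffOn_ginv a e) (hG.contDiffOn e d) hy]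
  have h2 : pd c (ginv G a b) y
      = ∑ d, (∑ e, pd c (ginv G a e) y * G y e d) * ginv G d b y := by
    calc pd c (ginv G a b) y
        = ∑ e, pd c (ginv G a e) y * ∑ d, G y e d * ginv G d b y := by
          simp [hG.sum_mul_ginv hy]
      _ = _ := by
          simp only [Finset.mul_sum, Finset.sum_mul]
          rw [Finset.sum_comm]
          simp only [mul_assoc]
  have h3 : ∀ d, ∑ e, pd c (ginv G a e) y * G y e d
      = - christoffel G a c d y - ∑ f, (∑ e, ginv G a e y * christoffel G f c e y) * G y f d := by
    intro d
    have h := key d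
    rw [Finset.sum_add_distrib] at h
    have h4 : ∑ e, ginv G a e y * pd c (fun z => G z e d) y
        = christoffel G a c d y
          + ∑ f, (∑ e, ginv G a e y * christoffel G f c e y) * G y f d := by
      have h5 : christoffel G a c d y
          = ∑ f, (∑ e, ginv G a e y * G y e f) * christoffel G f c d y := by
        simp [hG.sum_ginv_mul hy]
      rw [h5]
      simp only [hG.pd_metric hy, Finset.mul_sum, Finset.sum_mul, mul_add, Finset.sum_add_distrib]
      rw [add_comm]
      congr 1
      · rw [Finset.sum_comm]
        refine Finset.sum_congr rfl fun d _ => Finset.sum_congr rfl fun e _ => ?_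
        ring
      · rw [Finset.sum_comm]
        refine Finset.sum_congr rfl fun d _ => Finset.sum_congr rfl fun e _ => ?_
        ring
    linarith
  rw [h2]
  simp only [h3, sub_mul, Finset.sum_sub_distrib, neg_mul, Finset.sum_neg_distrib]
  congr 1
  calc ∑ d, (∑ f, (∑ e, ginv G a e y * christoffel G f c e y) * G y f d) * ginv G d b y
      = ∑ f, (∑ e, ginv G a e y * christoffel G f c e y) * ∑ d, G y f d * ginv G d b y := by
        exact sum_mul_sum_assoc _ (fun f d => G y f d) _
    _ = _ := by
        simp [hG.sum_mul_ginv hy, mul_comm]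

end IsMetricOn

/-! ### Covariant derivatives in curried form -/

section CurriedDerivatives

variable (G : MetricField)

/-- The covariant derivative `∇_c v_a` of a covector field, with curried indices. -/
def cov1 (v : Fin 4 → E4 → ℝ) (c a : Fin 4) (y : E4) : ℝ :=
  pd c (v a) y - ∑ e, christoffel G e c a y * v e y

/-- The covariant derivative `∇_c T_{ab}`, with curried indices. -/
def cov2 (T : Fin 4 → Fin 4 → E4 → ℝ) (c a b : Fin 4) (y : E4) : ℝ :=
  pd c (T a b) y - ∑ e, christoffel G e c a y * T e b y - ∑ e, christoffel G e c b y * T a e y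

/-- The covariant derivative `∇_c T_{abd}`, with curried indices. -/
def cov3 (T : Fin 4 → Fin 4 → Fin 4 → E4 → ℝ) (c a b d : Fin 4) (y : E4) : ℝ :=
  pd c (T a b d) y - ∑ e, christoffel G e c a y * T e b d y
    - ∑ e, christoffel G e c b y * T a e d y - ∑ e, christoffel G e c d y * T a b e y

/-- The covariant derivative `∇_p T_{abcd}`, with curried indices. -/
def cov4 (T : Fin 4 → Fin 4 → Fin 4 → Fin 4 → E4 → ℝ) (p a b c d : Fin 4) (y : E4) : ℝ :=
  pd p (T a b c d) y - ∑ e, christoffel G e p a y * T e b c d y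
    - ∑ e, christoffel G e p b y * T a e c d y - ∑ e, christoffel G e p c y * T a b e d y
    - ∑ e, christoffel G e p d y * T a b c e y

/-- The covariant derivative `∇_p T_{qabcd}`, with curried indices. -/
def cov5 (T : Fin 4 → Fin 4 → Fin 4 → Fin 4 → Fin 4 → E4 → ℝ) (p q a b c d : Fin 4) (y : E4) :
    ℝ :=
  pd p (T q a b c d) y - ∑ e, christoffel G e p q y * T e a b c d y
    - ∑ e, christoffel G e p a y * T q e b c d y
    - ∑ e, christoffel G e p b y * T q a e c d y - ∑ e, christoffel G e p c y * T q a b e d y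
    - ∑ e, christoffel G e p d y * T q a b c e y

variable {G} {y : E4}

lemma covDeriv_one (T : TensorField 1) (c a : Fin 4) :
    covDeriv G T ![c, a] y = cov1 G (fun a => T ![a]) c a y := by
  have h0 : (fun s : Fin 1 => (![c, a] : Fin 2 → Fin 4) s.succ) = ![a] := by
    ext s; fin_cases s; rfl
  have u0 : ∀ e, Function.update ![a] 0 e = ![e] := by
    intro e; ext s; fin_cases s; rfl
  unfold covDeriv cov1
  rw [h0]
  simp [u0]

lemma covDeriv_zero (f : E4 → ℝ) (I : Fin 1 → Fin 4) :
    covDeriv G (fun _ : Fin 0 → Fin 4 => f) I y = pd (I 0) f y := by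
  simp [covDeriv]

lemma covDeriv_four (T : TensorField 4) (p a b c d : Fin 4) :
    covDeriv G T ![p, a, b, c, d] y = cov4 G (fun a b c d => T ![a, b, c, d]) p a b c d y := by
  have h0 : (fun s : Fin 4 => (![p, a, b, c, d] : Fin 5 → Fin 4) s.succ) = ![a, b, c, d] := by
    ext s; fin_cases s <;> rfl
  have u0 : ∀ e, Function.update ![a, b, c, d] 0 e = ![e, b, c, d] := by
    intro e; ext s; fin_cases s <;> rfl
  have u1 : ∀ e, Function.update ![a, b, c, d] 1 e = ![a, e, c, d] := by
    intro e; ext s; fin_cases s <;> rfl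
  have u2 : ∀ e, Function.update ![a, b, c, d] 2 e = ![a, b, e, d] := by
    intro e; ext s; fin_cases s <;> rfl
  have u3 : ∀ e, Function.update ![a, b, c, d] 3 e = ![a, b, c, e] := by
    intro e; ext s; fin_cases s <;> rfl
  unfold covDeriv cov4
  rw [h0, Fin.sum_univ_four]
  simp only [u0, u1, u2, u3]
  simp only [sub_sub, add_assoc]
  rfl

lemma covDeriv_five (T : TensorField 5) (p q a b c d : Fin 4) :
    covDeriv G T ![p, q, a, b, c, d] y
      = cov5 G (fun q a b c d => T ![q, a, b, c, d]) p q a b c d y := by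
  have h0 : (fun s : Fin 5 => (![p, q, a, b, c, d] : Fin 6 → Fin 4) s.succ)
      = ![q, a, b, c, d] := by
    ext s; fin_cases s <;> rfl
  have u0 : ∀ e, Function.update ![q, a, b, c, d] 0 e = ![e, a, b, c, d] := by
    intro e; ext s; fin_cases s <;> rfl
  have u1 : ∀ e, Function.update ![q, a, b, c, d] 1 e = ![q, e, b, c, d] := by
    intro e; ext s; fin_cases s <;> rfl
  have u2 : ∀ e, Function.update ![q, a, b, c, d] 2 e = ![q, a, e, c, d] := by
    intro e; ext s; fin_cases s <;> rfl
  have u3 : ∀ e, Function.update ![q, a, b, c, d] 3 e = ![q, a, b, e, d] := by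
    intro e; ext s; fin_cases s <;> rfl
  have u4 : ∀ e, Function.update ![q, a, b, c, d] 4 e = ![q, a, b, c, e] := by
    intro e; ext s; fin_cases s <;> rfl
  unfold covDeriv cov5
  rw [h0, Fin.sum_univ_five]
  simp only [u0, u1, u2, u3, u4]
  simp only [sub_sub, add_assoc]
  rfl

variable {U : Set E4}

lemma cov1_congr (hU : IsOpen U) {v w : Fin 4 → E4 → ℝ} (h : ∀ a, ∀ z ∈ U, v a z = w a z)
    (hy : y ∈ U) (c a : Fin 4) : cov1 G v c a y = cov1 G w c a y := by
  unfold cov1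
  rw [pd_congr hU (h a) hy]
  simp only [h _ y hy]

lemma cov2_congr (hU : IsOpen U) {T S : Fin 4 → Fin 4 → E4 → ℝ}
    (h : ∀ a b, ∀ z ∈ U, T a b z = S a b z) (hy : y ∈ U) (c a b : Fin 4) :
    cov2 G T c a b y = cov2 G S c a b y := by
  unfold cov2
  rw [pd_congr hU (h a b) hy]
  simp only [h _ _ y hy]

lemma cov3_congr (hU : IsOpen U) {T S : Fin 4 → Fin 4 → Fin 4 → E4 → ℝ}
    (h : ∀ a b d, ∀ z ∈ U, T a b d z = S a b d z) (hy : y ∈ U) (c a b d : Fin 4) :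
    cov3 G T c a b d y = cov3 G S c a b d y := by
  unfold cov3
  rw [pd_congr hU (h a b d) hy]
  simp only [h _ _ _ y hy]

lemma cov4_congr (hU : IsOpen U) {T S : Fin 4 → Fin 4 → Fin 4 → Fin 4 → E4 → ℝ}
    (h : ∀ a b c d, ∀ z ∈ U, T a b c d z = S a b c d z) (hy : y ∈ U) (p a b c d : Fin 4) :
    cov4 G T p a b c d y = cov4 G S p a b c d y := by
  unfold cov4
  rw [pd_congr hU (h a b c d) hy]
  simp only [h _ _ _ _ y hy]

end CurriedDerivatives

namespace IsMetricOn

variable {U : Set E4} {G : MetricField} {y : E4} (hG : IsMetricOn U G)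
include hG

section Smooth

lemma contDiffOn_cov1 {v : Fin 4 → E4 → ℝ} (hv : ∀ a, ContDiffOn ℝ ∞ (v a) U) (c a : Fin 4) :
    ContDiffOn ℝ ∞ (cov1 G v c a) U :=
  (contDiffOn_pd hG.isOpen (hv a) c).sub
    (contDiffOn_sum fun e => (hG.contDiffOn_christoffel e c a).mul (hv e))

lemma contDiffOn_cov2 {T : Fin 4 → Fin 4 → E4 → ℝ} (hT : ∀ a b, ContDiffOn ℝ ∞ (T a b) U)
    (c a b : Fin 4) : ContDiffOn ℝ ∞ (cov2 G T c a b) U :=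
  ((contDiffOn_pd hG.isOpen (hT a b) c).sub
    (contDiffOn_sum fun e => (hG.contDiffOn_christoffel e c a).mul (hT e b))).sub
    (contDiffOn_sum fun e => (hG.contDiffOn_christoffel e c b).mul (hT a e))

lemma contDiffOn_cov4 {T : Fin 4 → Fin 4 → Fin 4 → Fin 4 → E4 → ℝ}
    (hT : ∀ a b c d, ContDiffOn ℝ ∞ (T a b c d) U) (p a b c d : Fin 4) :
    ContDiffOn ℝ ∞ (cov4 G T p a b c d) U :=
  ((((contDiffOn_pd hG.isOpen (hT a b c d) p).sub
    (contDiffOn_sum fun e => (hG.contDiffOn_christoffel e p a).mul (hT e b c d))).sub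
    (contDiffOn_sum fun e => (hG.contDiffOn_christoffel e p b).mul (hT a e c d))).sub
    (contDiffOn_sum fun e => (hG.contDiffOn_christoffel e p c).mul (hT a b e d))).sub
    (contDiffOn_sum fun e => (hG.contDiffOn_christoffel e p d).mul (hT a b c e))

end Smooth

/-! ### Contraction commutes with the covariant derivative -/

section Contraction

/-- The partial derivative of a trace is the trace of the covariant derivative, by `∇ g⁻¹ = 0`.
Contraction of two slots of a tensor with more indices reduces to this case, the remaining slots
being parameters. -/
lemma contr_pd {f : Fin 4 → Fin 4 → E4 → ℝ} (hf : ∀ d q, ContDiffOn ℝ ∞ (f d q) U) (hy : y ∈ U)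
    (p : Fin 4) :
    ∑ d, ∑ q, ginv G d q y * cov2 G f p d q y
      = pd p (fun z => ∑ d, ∑ q, ginv G d q z * f d q z) y := by
  have hU := hG.isOpen
  rw [pd_sum hU (fun d => contDiffOn_sum fun q => (hG.contDiffOn_ginv d q).mul (hf d q)) hy]
  have h1 : ∀ d, pd p (fun z => ∑ q, ginv G d q z * f d q z) y
      = ∑ q, (pd p (ginv G d q) y * f d q y + ginv G d q y * pd p (f d q) y) := by
    intro d
    rw [pd_sum hU (fun q => (hG.contDiffOn_ginv d q).mul (hf d q)) hy]
    exact Finset.sum_congr rfl fun q _ => pd_mul hU (hG.contDiffOn_ginv d q) (hf d q) hy p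
  simp only [h1, hG.pd_ginv hy, cov2]
  simp only [mul_sub, sub_mul, neg_mul, Finset.sum_add_distrib, Finset.sum_sub_distrib,
    Finset.sum_neg_distrib, Finset.mul_sum, Finset.sum_mul]
  have e1 : ∑ d, ∑ q, ∑ e, ginv G d q y * (christoffel G e p d y * f e q y)
      = ∑ d, ∑ q, ∑ e, christoffel G d p e y * ginv G e q y * f d q y := by
    rw [Finset.sum_comm]
    symm
    rw [Finset.sum_comm]
    refine Finset.sum_congr rfl fun q _ => ?_
    rw [Finset.sum_comm]
    refine Finset.sum_congr rfl fun d _ => Finset.sum_congr rfl fun e _ => ?_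
    ring
  have e2 : ∑ d, ∑ q, ∑ e, ginv G d q y * (christoffel G e p q y * f d e y)
      = ∑ d, ∑ q, ∑ e, christoffel G q p e y * ginv G d e y * f d q y := by
    refine Finset.sum_congr rfl fun d _ => ?_
    rw [Finset.sum_comm]
    refine Finset.sum_congr rfl fun q _ => Finset.sum_congr rfl fun e _ => ?_
    ring
  rw [e1, e2]
  ring

omit hG in
lemma contr_sum_comm (X : Fin 4 → ℝ) (A : Fin 4 → Fin 4 → ℝ) (B : Fin 4 → Fin 4 → Fin 4 → ℝ) :
    ∑ d, ∑ q, A d q * ∑ e, X e * B e d q = ∑ e, X e * ∑ d, ∑ q, A d q * B e d q := by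
  simp only [Finset.mul_sum]
  have h : ∀ d, ∑ q, ∑ e, A d q * (X e * B e d q) = ∑ e, ∑ q, X e * (A d q * B e d q) := by
    intro d
    rw [Finset.sum_comm]
    refine Finset.sum_congr rfl fun e _ => Finset.sum_congr rfl fun q _ => ?_
    ring
  simp only [h]
  rw [Finset.sum_comm]

omit hG in
lemma contr_contr_comm (A B : Fin 4 → Fin 4 → ℝ) (C : Fin 4 → Fin 4 → Fin 4 → Fin 4 → ℝ) :
    ∑ a, ∑ b, A a b * ∑ d, ∑ q, B d q * C a b d q
      = ∑ d, ∑ q, B d q * ∑ a, ∑ b, A a b * C a b d q := by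
  simp only [Finset.mul_sum]
  have h1 : ∀ a, ∑ b, ∑ d, ∑ q, A a b * (B d q * C a b d q)
      = ∑ d, ∑ b, ∑ q, A a b * (B d q * C a b d q) := fun a => Finset.sum_comm
  simp only [h1]
  rw [Finset.sum_comm]
  refine Finset.sum_congr rfl fun d _ => ?_
  have h2 : ∀ a, ∑ b, ∑ q, A a b * (B d q * C a b d q)
      = ∑ q, ∑ b, A a b * (B d q * C a b d q) := fun a => Finset.sum_comm
  simp only [h2]
  rw [Finset.sum_comm]
  refine Finset.sum_congr rfl fun q _ => Finset.sum_congr rfl fun a _ =>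
    Finset.sum_congr rfl fun b _ => ?_
  ring

lemma contr_cov3 {T : Fin 4 → Fin 4 → Fin 4 → E4 → ℝ} (hT : ∀ a b c, ContDiffOn ℝ ∞ (T a b c) U)
    (hy : y ∈ U) (p a : Fin 4) :
    ∑ d, ∑ q, ginv G d q y * cov3 G T p q a d y
      = cov1 G (fun a z => ∑ d, ∑ q, ginv G d q z * T q a d z) p a y := by
  rw [cov1, ← hG.contr_pd (f := fun d q => T q a d) (fun d q => hT q a d) hy,
    ← contr_sum_comm, ← Finset.sum_sub_distrib]
  refine Finset.sum_congr rfl fun d _ => ?_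
  rw [← Finset.sum_sub_distrib]
  refine Finset.sum_congr rfl fun q _ => ?_
  simp only [cov2, cov3]
  ring

lemma contr_cov4 {T : Fin 4 → Fin 4 → Fin 4 → Fin 4 → E4 → ℝ}
    (hT : ∀ a b c d, ContDiffOn ℝ ∞ (T a b c d) U) (hy : y ∈ U) (p b c : Fin 4) :
    ∑ d, ∑ q, ginv G d q y * cov4 G T p b d c q y
      = cov2 G (fun b c z => ∑ d, ∑ q, ginv G d q z * T b d c q z) p b c y := by
  rw [cov2, ← hG.contr_pd (f := fun d q => T b d c q) (fun d q => hT b d c q) hy,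
    ← contr_sum_comm, ← contr_sum_comm, ← Finset.sum_sub_distrib, ← Finset.sum_sub_distrib]
  refine Finset.sum_congr rfl fun d _ => ?_
  rw [← Finset.sum_sub_distrib, ← Finset.sum_sub_distrib]
  refine Finset.sum_congr rfl fun q _ => ?_
  simp only [cov2, cov4]
  ring

lemma contr_cov5 {T : Fin 4 → Fin 4 → Fin 4 → Fin 4 → Fin 4 → E4 → ℝ}
    (hT : ∀ q a b c d, ContDiffOn ℝ ∞ (T q a b c d) U) (hy : y ∈ U) (p a c b : Fin 4) :
    ∑ d, ∑ q, ginv G d q y * cov5 G T p q a c b d y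
      = cov3 G (fun a c b z => ∑ d, ∑ q, ginv G d q z * T q a c b d z) p a c b y := by
  -- The Christoffel terms of the uncontracted slots come out of the trace.
  rw [cov3, ← hG.contr_pd (f := fun d q => T q a c b d) (fun d q => hT q a c b d) hy,
    ← contr_sum_comm, ← contr_sum_comm, ← contr_sum_comm, ← Finset.sum_sub_distrib,
    ← Finset.sum_sub_distrib, ← Finset.sum_sub_distrib]
  refine Finset.sum_congr rfl fun d _ => ?_
  rw [← Finset.sum_sub_distrib, ← Finset.sum_sub_distrib, ← Finset.sum_sub_distrib]
  refine Finset.sum_congr rfl fun q _ => ?_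
  simp only [cov2, cov5]
  ring

end Contraction

/-! ### Leibniz rules -/

section Leibniz

lemma cov2_metric (hy : y ∈ U) (c a b : Fin 4) :
    cov2 G (fun a b z => G z a b) c a b y = 0 := by
  rw [cov2, hG.pd_metric hy]
  ring

lemma cov2_mul {u v : Fin 4 → E4 → ℝ} (hu : ∀ a, ContDiffOn ℝ ∞ (u a) U)
    (hv : ∀ a, ContDiffOn ℝ ∞ (v a) U) (hy : y ∈ U) (c a b : Fin 4) :
    cov2 G (fun a b z => u a z * v b z) c a b y
      = cov1 G u c a y * v b y + u a y * cov1 G v c b y := by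
  simp only [cov1, cov2, pd_mul hG.isOpen (hu a) (hv b) hy, sub_mul, mul_sub, Finset.mul_sum,
    Finset.sum_mul]
  simp only [mul_assoc, mul_left_comm (u a y)]
  ring

lemma cov3_mul_covector {T : Fin 4 → Fin 4 → E4 → ℝ} {v : Fin 4 → E4 → ℝ}
    (hT : ∀ a b, ContDiffOn ℝ ∞ (T a b) U) (hv : ∀ a, ContDiffOn ℝ ∞ (v a) U) (hy : y ∈ U)
    (p q a b : Fin 4) :
    cov3 G (fun q a b z => T q a z * v b z) p q a b y
      = cov2 G T p q a y * v b y + T q a y * cov1 G v p b y := by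
  simp only [cov1, cov2, cov3, pd_mul hG.isOpen (hT q a) (hv b) hy, sub_mul, mul_sub,
    Finset.mul_sum, Finset.sum_mul]
  simp only [mul_assoc, mul_left_comm (T q a y)]
  ring

lemma cov3_covector_mul {T : Fin 4 → Fin 4 → E4 → ℝ} {u : Fin 4 → E4 → ℝ}
    (hT : ∀ a b, ContDiffOn ℝ ∞ (T a b) U) (hu : ∀ a, ContDiffOn ℝ ∞ (u a) U) (hy : y ∈ U)
    (p q a b : Fin 4) :
    cov3 G (fun q a b z => u a z * T q b z) p q a b y
      = cov1 G u p a y * T q b y + u a y * cov2 G T p q b y := by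
  simp only [cov1, cov2, cov3, pd_mul hG.isOpen (hu a) (hT q b) hy, sub_mul, mul_sub,
    Finset.mul_sum, Finset.sum_mul]
  simp only [mul_assoc, mul_left_comm (u a y)]
  ring

lemma cov1_smul {u : E4 → ℝ} {v : Fin 4 → E4 → ℝ} (hu : ContDiffOn ℝ ∞ u U)
    (hv : ∀ a, ContDiffOn ℝ ∞ (v a) U) (hy : y ∈ U) (c a : Fin 4) :
    cov1 G (fun a z => u z * v a z) c a y = pd c u y * v a y + u y * cov1 G v c a y := by
  simp only [cov1, pd_mul hG.isOpen hu (hv a) hy, mul_sub, Finset.mul_sum]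
  simp only [mul_left_comm (u y)]
  ring

omit hG in
lemma cov3_add (hU : IsOpen U) {S T : Fin 4 → Fin 4 → Fin 4 → E4 → ℝ}
    (hS : ∀ a b d, ContDiffOn ℝ ∞ (S a b d) U)
    (hT : ∀ a b d, ContDiffOn ℝ ∞ (T a b d) U) (hy : y ∈ U) (c a b d : Fin 4) :
    cov3 G (fun a b d z => S a b d z + T a b d z) c a b d y
      = cov3 G S c a b d y + cov3 G T c a b d y := by
  simp only [cov3, pd_add hU (hS a b d) (hT a b d) hy, mul_add, Finset.sum_add_distrib]
  ring

end Leibniz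

end IsMetricOn
namespace IsMetricOn

variable {U : Set E4} {G : MetricField} {y : E4} (hG : IsMetricOn U G)
include hG

/-! ### Curvature identities -/

section Curvature

lemma contDiffOn_riemannUp (a b c d : Fin 4) : ContDiffOn ℝ ∞ (riemannUp G a b c d) U := by
  have h := hG.contDiffOn_christoffel
  exact ((contDiffOn_pd hG.isOpen (h _ _ _) _).sub (contDiffOn_pd hG.isOpen (h _ _ _) _)).add
    (contDiffOn_sum fun e => ((h _ _ _).mul (h _ _ _)).sub ((h _ _ _).mul (h _ _ _)))

lemma contDiffOn_riemann (a b c d : Fin 4) : ContDiffOn ℝ ∞ (riemann G a b c d) U :=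
  contDiffOn_sum fun e => (hG.contDiffOn a e).mul (hG.contDiffOn_riemannUp e b c d)

lemma contDiffOn_ricci (a b : Fin 4) : ContDiffOn ℝ ∞ (ricci G a b) U :=
  contDiffOn_sum fun _ => hG.contDiffOn_riemannUp _ _ _ _

lemma pd_cov2 {T : Fin 4 → Fin 4 → E4 → ℝ}
    (hT : ∀ a b, ContDiffOn ℝ ∞ (T a b) U) (hy : y ∈ U) (p q a b : Fin 4) :
    pd p (cov2 G T q a b) y = pd p (pd q (T a b)) y
      - ∑ e, (pd p (christoffel G e q a) y * T e b y + christoffel G e q a y * pd p (T e b) y)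
      - ∑ e, (pd p (christoffel G e q b) y * T a e y
          + christoffel G e q b y * pd p (T a e) y) := by
  have hU := hG.isOpen
  have hΓ := hG.contDiffOn_christoffel
  have h1 : ∀ e, ContDiffOn ℝ ∞ (fun z => christoffel G e q a z * T e b z) U :=
    fun e => (hΓ e q a).mul (hT e b)
  have h2 : ∀ e, ContDiffOn ℝ ∞ (fun z => christoffel G e q b z * T a e z) U :=
    fun e => (hΓ e q b).mul (hT a e)
  have h3 := contDiffOn_pd hU (hT a b) q
  unfold cov2
  rw [pd_sub hU (h3.sub (contDiffOn_sum h1)) (contDiffOn_sum h2) hy,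
    pd_sub hU h3 (contDiffOn_sum h1) hy, pd_sum hU h1 hy, pd_sum hU h2 hy]
  simp only [pd_mul hU (hΓ _ _ _) (hT _ _) hy]

/-- The Ricci identity for a tensor of rank two. -/
lemma ricci_identity {T : Fin 4 → Fin 4 → E4 → ℝ}
    (hT : ∀ a b, ContDiffOn ℝ ∞ (T a b) U) (hy : y ∈ U) (p q a b : Fin 4) :
    cov3 G (cov2 G T) p q a b y - cov3 G (cov2 G T) q p a b y
      = - ∑ e, riemannUp G e a p q y * T e b y - ∑ e, riemannUp G e b p q y * T a e y := by
  have hc : ∀ e, christoffel G e q p y = christoffel G e p q y :=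
    fun e => hG.christoffel_symm hy e q p
  unfold cov3
  rw [hG.pd_cov2 hT hy, hG.pd_cov2 hT hy, pd_comm hG.isOpen (hT a b) hy p q]
  simp only [hc]
  unfold cov2 riemannUp
  simp only [Fin.sum_univ_four]
  ring

omit hG in
lemma riemann_antisymm_right (a b c d : Fin 4) :
    riemann G a b c d y = - riemann G a b d c y := by
  unfold riemann riemannUp
  rw [← Finset.sum_neg_distrib]
  refine Finset.sum_congr rfl fun e _ => ?_
  rw [Finset.sum_sub_distrib, Finset.sum_sub_distrib]
  ring

/-- The Ricci identity applied to the metric. -/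
lemma riemann_antisymm_left (hy : y ∈ U) (a b c d : Fin 4) :
    riemann G a b c d y = - riemann G b a c d y := by
  have h0 : ∀ p q a b, cov3 G (cov2 G (fun a b z => G z a b)) p q a b y = 0 := by
    intro p q a b
    rw [cov3_congr (S := fun _ _ _ _ => 0) hG.isOpen (fun a b d z hz => hG.cov2_metric hz a b d) hy]
    simp [cov3, pd_const]
  have h := hG.ricci_identity hG.contDiffOn hy c d a b
  rw [h0, h0] at h
  have e1 : riemann G b a c d y = ∑ e, riemannUp G e a c d y * G y e b :=
    Finset.sum_congr rfl fun e _ => by rw [hG.symm y hy b e, mul_comm]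
  have e2 : riemann G a b c d y = ∑ e, riemannUp G e b c d y * G y a e :=
    Finset.sum_congr rfl fun e _ => by rw [mul_comm]
  rw [e1, e2]
  linarith

lemma riemannUp_cyclic (hy : y ∈ U) (a b c d : Fin 4) :
    riemannUp G a b c d y + riemannUp G a c d b y + riemannUp G a d b c y = 0 := by
  have hs : ∀ e b c, ∀ z ∈ U, christoffel G e b c z = christoffel G e c b z :=
    fun e b c z hz => hG.christoffel_symm hz e b c
  have hp : ∀ p e b c, pd p (christoffel G e b c) y = pd p (christoffel G e c b) y :=
    fun p e b c => pd_congr hG.isOpen (hs e b c) hy p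
  unfold riemannUp
  rw [hp c a d b, hp d a c b, hp b a d c]
  simp only [fun e => hs e d b y hy, fun e => hs e c b y hy, fun e => hs e d c y hy,
    Finset.sum_sub_distrib]
  ring

lemma riemann_cyclic (hy : y ∈ U) (a b c d : Fin 4) :
    riemann G a b c d y + riemann G a c d b y + riemann G a d b c y = 0 := by
  unfold riemann
  rw [← Finset.sum_add_distrib, ← Finset.sum_add_distrib]
  refine Finset.sum_eq_zero fun e _ => ?_
  rw [← mul_add, ← mul_add, hG.riemannUp_cyclic hy, mul_zero]

lemma riemann_pair_symm (hy : y ∈ U) (a b c d : Fin 4) :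
    riemann G a b c d y = riemann G c d a b y := by
  have c1 := hG.riemann_cyclic hy a b c d
  have c2 := hG.riemann_cyclic hy b c d a
  have c3 := hG.riemann_cyclic hy c d a b
  have c4 := hG.riemann_cyclic hy d a b c
  have l := hG.riemann_antisymm_left hy
  have r := fun a b c d => riemann_antisymm_right (G := G) (y := y) a b c d
  linarith [l a b c d, l c d a b, l a c d b, l a d b c, l b c d a, l b d a c, r a b c d,
    r a c d b, r a d b c, r b c d a, r b d a c, r b a c d, r c d a b, r c a b d, r c b d a,
    r d a b c, r d b c a, r d c a b, l c a b d, l c b d a, l d a b c, l d b c a, l d c a b,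
    l b a c d, r c b a d, r d c b a, r b a d c, r b d c a, r d b a c, r c a d b]

lemma pd_riemannUp (hy : y ∈ U) (p a b c d : Fin 4) :
    pd p (riemannUp G a b c d) y = pd p (pd c (christoffel G a d b)) y
      - pd p (pd d (christoffel G a c b)) y
      + ∑ e, (pd p (christoffel G a c e) y * christoffel G e d b y
        + christoffel G a c e y * pd p (christoffel G e d b) y
        - (pd p (christoffel G a d e) y * christoffel G e c b y
        + christoffel G a d e y * pd p (christoffel G e c b) y)) := by
  have hU := hG.isOpen
  have h := hG.contDiffOn_christoffel
  have h1 : ∀ e, ContDiffOn ℝ ∞ (fun z => christoffel G a c e z * christoffel G e d b z) U :=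
    fun e => (h _ _ _).mul (h _ _ _)
  have h2 : ∀ e, ContDiffOn ℝ ∞ (fun z => christoffel G a d e z * christoffel G e c b z) U :=
    fun e => (h _ _ _).mul (h _ _ _)
  have h3 := fun c d => contDiffOn_pd hU (h a d b) c
  unfold riemannUp
  rw [pd_add hU ((h3 c d).sub (h3 d c)) (contDiffOn_sum fun e => (h1 e).sub (h2 e)) hy,
    pd_sub hU (h3 c d) (h3 d c) hy, pd_sum hU (fun e => (h1 e).sub (h2 e)) hy]
  congr 1
  refine Finset.sum_congr rfl fun e _ => ?_
  rw [pd_sub hU (h1 e) (h2 e) hy, pd_mul hU (h _ _ _) (h _ _ _) hy,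
    pd_mul hU (h _ _ _) (h _ _ _) hy]

/-- The second Bianchi identity for the curvature two-forms, `D R^a_b = 0`. -/
lemma riemannUp_bianchi (hy : y ∈ U) (p a b c d : Fin 4) :
    (pd p (riemannUp G a b c d) y + ∑ h, (christoffel G a p h y * riemannUp G h b c d y
        - christoffel G h p b y * riemannUp G a h c d y))
    + (pd c (riemannUp G a b d p) y + ∑ h, (christoffel G a c h y * riemannUp G h b d p y
        - christoffel G h c b y * riemannUp G a h d p y))
    + (pd d (riemannUp G a b p c) y + ∑ h, (christoffel G a d h y * riemannUp G h b p c y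
        - christoffel G h d b y * riemannUp G a h p c y)) = 0 := by
  have hc : ∀ p q r, pd p (pd q (christoffel G a r b)) y = pd q (pd p (christoffel G a r b)) y :=
    fun p q r => pd_comm hG.isOpen (hG.contDiffOn_christoffel _ _ _) hy p q
  simp only [hG.pd_riemannUp hy]
  rw [hc p c d, hc p d c, hc c d p]
  unfold riemannUp
  simp only [Fin.sum_univ_four]
  ring

/-- Lowering the first index commutes with the covariant derivative. -/
lemma cov4_riemann (hy : y ∈ U) (p a b c d : Fin 4) :
    cov4 G (riemann G) p a b c d y
      = ∑ f, G y a f * (pd p (riemannUp G f b c d) y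
        + ∑ h, (christoffel G f p h y * riemannUp G h b c d y
          - christoffel G h p b y * riemannUp G f h c d y)
        - ∑ h, christoffel G h p c y * riemannUp G f b h d y
        - ∑ h, christoffel G h p d y * riemannUp G f b c h y) := by
  have hU := hG.isOpen
  have h1 : pd p (riemann G a b c d) y
      = ∑ f, (pd p (fun z => G z a f) y * riemannUp G f b c d y
        + G y a f * pd p (riemannUp G f b c d) y) := by
    unfold riemann
    rw [pd_sum hU (fun f => (hG.contDiffOn a f).mul (hG.contDiffOn_riemannUp f b c d)) hy]
    exact Finset.sum_congr rfl fun f _ =>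
      pd_mul hU (hG.contDiffOn a f) (hG.contDiffOn_riemannUp f b c d) hy p
  unfold cov4
  rw [h1]
  simp only [hG.pd_metric hy]
  unfold riemann
  simp only [Fin.sum_univ_four]
  ring

/-- The second Bianchi identity. -/
lemma bianchi (hy : y ∈ U) (p a b c d : Fin 4) :
    cov4 G (riemann G) p a b c d y + cov4 G (riemann G) c a b d p y
      + cov4 G (riemann G) d a b p c y = 0 := by
  have anti : ∀ a b c d, riemannUp G a b c d y = - riemannUp G a b d c y := by
    intro a b c d
    unfold riemannUp
    rw [Finset.sum_sub_distrib, Finset.sum_sub_distrib]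
    ring
  simp only [hG.cov4_riemann hy]
  rw [← Finset.sum_add_distrib, ← Finset.sum_add_distrib]
  refine Finset.sum_eq_zero fun f _ => ?_
  have h := hG.riemannUp_bianchi hy p f b c d
  have s1 : ∑ h, christoffel G h c p y * riemannUp G f b d h y
      = - ∑ h, christoffel G h p c y * riemannUp G f b h d y := by
    rw [← Finset.sum_neg_distrib]
    exact Finset.sum_congr rfl fun h _ => by rw [hG.christoffel_symm hy h c p, anti f b d h]; ring
  have s2 : ∑ h, christoffel G h d p y * riemannUp G f b h c y
      = - ∑ h, christoffel G h p d y * riemannUp G f b c h y := by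
    rw [← Finset.sum_neg_distrib]
    exact Finset.sum_congr rfl fun h _ => by rw [hG.christoffel_symm hy h d p, anti f b h c]; ring
  have s3 : ∑ h, christoffel G h d c y * riemannUp G f b p h y
      = - ∑ h, christoffel G h c d y * riemannUp G f b h p y := by
    rw [← Finset.sum_neg_distrib]
    exact Finset.sum_congr rfl fun h _ => by rw [hG.christoffel_symm hy h d c, anti f b p h]; ring
  rw [s1, s2, s3]
  linear_combination G y a f * h

/-- Contracting the second and fourth indices of the Riemann tensor yields the Ricci tensor. -/
lemma contr_riemann (hy : y ∈ U) (b c : Fin 4) :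
    ∑ d, ∑ q, ginv G d q y * riemann G b d c q y = ricci G b c y := by
  have h1 : ∀ d q, riemann G b d c q y = riemann G d b q c y := by
    intro d q
    rw [hG.riemann_antisymm_left hy, riemann_antisymm_right, neg_neg]
  have h2 : ∀ q, ∑ d, ginv G d q y * riemann G d b q c y = riemannUp G q b q c y := by
    intro q
    unfold riemann
    simp only [Finset.mul_sum]
    rw [Finset.sum_comm]
    have : ∀ e, ∑ d, ginv G d q y * (G y d e * riemannUp G e b q c y)
        = (∑ d, ginv G q d y * G y d e) * riemannUp G e b q c y := by
      intro e
      rw [Finset.sum_mul]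
      exact Finset.sum_congr rfl fun d _ => by rw [hG.ginv_symm hy d q]; ring
    simp [this, hG.sum_ginv_mul hy]
  simp only [h1]
  rw [Finset.sum_comm]
  simp only [h2]
  rfl

lemma ricci_symm (hy : y ∈ U) (a b : Fin 4) : ricci G a b y = ricci G b a y := by
  rw [← hG.contr_riemann hy, ← hG.contr_riemann hy, Finset.sum_comm]
  refine Finset.sum_congr rfl fun d _ => Finset.sum_congr rfl fun q _ => ?_
  rw [hG.ginv_symm hy, hG.riemann_pair_symm hy]

lemma cov4_riemann_pair_symm (hy : y ∈ U) (p a b c d : Fin 4) :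
    cov4 G (riemann G) p a b c d y = cov4 G (riemann G) p c d a b y := by
  rw [cov4_congr (T := riemann G) (S := fun a b c d => riemann G c d a b) hG.isOpen
    (fun a b c d z hz => hG.riemann_pair_symm hz a b c d) hy p a b c d]
  unfold cov4
  ring

lemma cov4_riemann_antisymm (hy : y ∈ U) (p a b c d : Fin 4) :
    cov4 G (riemann G) p a b c d y = - cov4 G (riemann G) p b a c d y := by
  rw [cov4_congr (T := riemann G) (S := fun a b c d z => (-1) * riemann G b a c d z) hG.isOpen
    (fun a b c d z hz => by rw [hG.riemann_antisymm_left hz a b c d]; ring) hy p a b c d]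
  unfold cov4
  rw [pd_mul hG.isOpen contDiffOn_const (hG.contDiffOn_riemann _ _ _ _) hy, pd_const]
  simp only [neg_mul, one_mul, mul_neg, Finset.sum_neg_distrib]
  ring

lemma contr_cov4_riemann (hy : y ∈ U) (p b c : Fin 4) :
    ∑ d, ∑ q, ginv G d q y * cov4 G (riemann G) p b d c q y = cov2 G (ricci G) p b c y := by
  rw [hG.contr_cov4 hG.contDiffOn_riemann hy]
  exact cov2_congr hG.isOpen (fun a b z hz => hG.contr_riemann hz a b) hy p b c

/-- The once contracted Bianchi identity `∇^d R_{acbd} = ∇_c R_{ba} - ∇_a R_{bc}`. -/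
lemma div_riemann (hy : y ∈ U) (a c b : Fin 4) :
    ∑ d, ∑ q, ginv G d q y * cov4 G (riemann G) q a c b d y
      = cov2 G (ricci G) c b a y - cov2 G (ricci G) a b c y := by
  rw [← hG.contr_cov4_riemann hy, ← hG.contr_cov4_riemann hy, ← Finset.sum_sub_distrib]
  refine Finset.sum_congr rfl fun d _ => ?_
  rw [← Finset.sum_sub_distrib]
  refine Finset.sum_congr rfl fun q _ => ?_
  have hb := hG.bianchi hy q b d a c
  have h2 : cov4 G (riemann G) c b d q a y = - cov4 G (riemann G) c b d a q y := by
    rw [hG.cov4_riemann_pair_symm hy c b d q a, hG.cov4_riemann_antisymm hy,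
      hG.cov4_riemann_pair_symm hy c a q b d]
  rw [hG.cov4_riemann_pair_symm hy q a c b d]
  linear_combination ginv G d q y * (hb - h2)

lemma cov2_ricci_symm (hy : y ∈ U) (p a b : Fin 4) :
    cov2 G (ricci G) p a b y = cov2 G (ricci G) p b a y := by
  rw [cov2_congr (T := ricci G) (S := fun a b => ricci G b a) hG.isOpen
    (fun a b z hz => hG.ricci_symm hz a b) hy p a b]
  unfold cov2
  ring

/-- The twice contracted Bianchi identity `2 ∇^b R_{ab} = ∂_a R`. -/
lemma div_ricci (hy : y ∈ U) (c : Fin 4) :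
    2 * ∑ d, ∑ q, ginv G d q y * cov2 G (ricci G) q c d y = pd c (scalarCurv G) y := by
  have h1 : ∑ a, ∑ b, ginv G a b y *
        (∑ d, ∑ q, ginv G d q y * cov4 G (riemann G) q a c b d y)
      = ∑ d, ∑ q, ginv G d q y * cov2 G (ricci G) q c d y := by
    have hs : ∀ d q, cov2 G (ricci G) q c d y
        = ∑ a, ∑ b, ginv G a b y * cov4 G (riemann G) q a c b d y := by
      intro d q
      rw [← hG.contr_cov4_riemann hy]
      refine Finset.sum_congr rfl fun a _ => Finset.sum_congr rfl fun b _ => ?_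
      rw [hG.cov4_riemann_antisymm hy, hG.cov4_riemann_pair_symm hy,
        hG.cov4_riemann_antisymm hy, hG.cov4_riemann_pair_symm hy, neg_neg]
    simp only [hs]
    exact contr_contr_comm _ _ _
  have h2 : ∑ a, ∑ b, ginv G a b y * cov2 G (ricci G) c b a y = pd c (scalarCurv G) y := by
    have : ∑ a, ∑ b, ginv G a b y * cov2 G (ricci G) c b a y
        = ∑ a, ∑ b, ginv G a b y * cov2 G (ricci G) c a b y :=
      Finset.sum_congr rfl fun a _ => Finset.sum_congr rfl fun b _ => by
        rw [hG.cov2_ricci_symm hy]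
    rw [this, hG.contr_pd hG.contDiffOn_ricci hy]
    rfl
  have h3 : ∑ a, ∑ b, ginv G a b y * cov2 G (ricci G) a b c y
      = ∑ d, ∑ q, ginv G d q y * cov2 G (ricci G) q c d y := by
    rw [Finset.sum_comm]
    refine Finset.sum_congr rfl fun d _ => Finset.sum_congr rfl fun q _ => ?_
    rw [hG.cov2_ricci_symm hy, hG.ginv_symm hy]
  simp only [hG.div_riemann hy, mul_sub, Finset.sum_sub_distrib] at h1
  rw [h2, h3] at h1
  linarith

end Curvature

end IsMetricOn
namespace IsMetricOn

variable {U : Set E4} {G : MetricField} {y : E4} (hG : IsMetricOn U G)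
include hG

/-! ### The Bach tensor of a metric of constant scalar curvature -/

section Bach

lemma contr_metric (hy : y ∈ U) : ∑ d, ∑ q, ginv G d q y * G y d q = 4 := by
  have h : ∀ d, ∑ q, ginv G d q y * G y d q = 1 := by
    intro d
    have := hG.sum_ginv_mul hy d d
    rw [if_pos rfl] at this
    rw [← this]
    exact Finset.sum_congr rfl fun q _ => by rw [hG.symm y hy]
  simp [h]

lemma contr_metric_mul (hy : y ∈ U) (X : Fin 4 → ℝ) (a : Fin 4) :
    ∑ d, ∑ q, ginv G d q y * (G y a d * X q) = X a := by
  rw [Finset.sum_comm]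
  have h : ∀ q, ∑ d, ginv G d q y * (G y a d * X q) = (∑ d, G y a d * ginv G d q y) * X q := by
    intro q
    rw [Finset.sum_mul]
    exact Finset.sum_congr rfl fun d _ => by ring
  simp [h, hG.sum_mul_ginv hy]

omit hG in
/-- The Weyl tensor is the Riemann tensor minus half the Kulkarni–Nomizu product of the metric with
`Ric - (R / 6) g`. -/
lemma weyl_eq {r : ℝ} (hr : scalarCurv G y = r) (a b c d : Fin 4) :
    weyl G ![a, b, c, d] y = riemann G a b c d y - (1 / 2 : ℝ) *
      (G y a c * (ricci G b d y - r / 6 * G y b d) - G y a d * (ricci G b c y - r / 6 * G y b c)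
        - G y b c * (ricci G a d y - r / 6 * G y a d)
        + G y b d * (ricci G a c y - r / 6 * G y a c)) := by
  rw [← hr]
  change riemann G a b c d y - (1 / 2 : ℝ) * (G y a c * ricci G b d y
        - G y a d * ricci G b c y - G y b c * ricci G a d y + G y b d * ricci G a c y)
    + (1 / 6 : ℝ) * scalarCurv G y * (G y a c * G y b d - G y a d * G y b c) = _
  ring

/-- As the metric is parallel, the Kulkarni–Nomizu product `g ∧ P` is differentiated in `P` only. -/
lemma cov4_sub_kulkarniNomizu {R : Fin 4 → Fin 4 → Fin 4 → Fin 4 → E4 → ℝ}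
    (hR : ∀ a b c d, ContDiffOn ℝ ∞ (R a b c d) U) {P : Fin 4 → Fin 4 → E4 → ℝ}
    (hP : ∀ a b, ContDiffOn ℝ ∞ (P a b) U) (hy : y ∈ U) (p a b c d : Fin 4) :
    cov4 G (fun a b c d z => R a b c d z - (1 / 2 : ℝ) * (G z a c * P b d z - G z a d * P b c z
        - G z b c * P a d z + G z b d * P a c z)) p a b c d y
      = cov4 G R p a b c d y - (1 / 2 : ℝ) * (G y a c * cov2 G P p b d y
        - G y a d * cov2 G P p b c y - G y b c * cov2 G P p a d y
        + G y b d * cov2 G P p a c y) := by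
  have hU := hG.isOpen
  have hg := hG.contDiffOn
  have hm : ∀ a b c d, ContDiffOn ℝ ∞ (fun z => G z a b * P c d z) U :=
    fun a b c d => (hg a b).mul (hP c d)
  have h1 := (hm a c b d).sub (hm a d b c)
  have h2 := h1.sub (hm b c a d)
  have hpd : pd p (fun z => R a b c d z - (1 / 2 : ℝ) * (G z a c * P b d z - G z a d * P b c z
        - G z b c * P a d z + G z b d * P a c z)) y
      = pd p (R a b c d) y - (1 / 2 : ℝ) *
        ((pd p (fun z => G z a c) y * P b d y + G y a c * pd p (P b d) y)
          - (pd p (fun z => G z a d) y * P b c y + G y a d * pd p (P b c) y)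
          - (pd p (fun z => G z b c) y * P a d y + G y b c * pd p (P a d) y)
          + (pd p (fun z => G z b d) y * P a c y + G y b d * pd p (P a c) y)) := by
    rw [pd_sub hU (hR a b c d) (contDiffOn_const.mul (h2.add (hm b d a c))) hy,
      pd_mul hU contDiffOn_const (h2.add (hm b d a c)) hy, pd_const,
      pd_add hU h2 (hm b d a c) hy, pd_sub hU h1 (hm b c a d) hy,
      pd_sub hU (hm a c b d) (hm a d b c) hy]
    simp only [pd_mul hU (hg _ _) (hP _ _) hy]
    ring
  unfold cov4
  rw [hpd]
  simp only [hG.pd_metric hy]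
  unfold cov2
  simp only [Fin.sum_univ_four]
  ring

lemma cov2_sub_metric {T : Fin 4 → Fin 4 → E4 → ℝ} (hT : ∀ a b, ContDiffOn ℝ ∞ (T a b) U)
    (r : ℝ) (hy : y ∈ U) (c a b : Fin 4) :
    cov2 G (fun a b z => T a b z - r * G z a b) c a b y = cov2 G T c a b y := by
  have hU := hG.isOpen
  have hg := hG.contDiffOn
  unfold cov2
  rw [pd_sub hU (hT a b) (contDiffOn_const.mul (hg a b)) hy, pd_mul hU contDiffOn_const (hg a b) hy,
    pd_const, hG.pd_metric hy]
  simp only [Fin.sum_univ_four]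
  ring

variable {r : ℝ} (hr : ∀ z ∈ U, scalarCurv G z = r)
include hr

lemma contDiffOn_weyl (a b c d : Fin 4) : ContDiffOn ℝ ∞ (fun z => weyl G ![a, b, c, d] z) U := by
  have hg := hG.contDiffOn
  have hP : ∀ a b, ContDiffOn ℝ ∞ (fun z => ricci G a b z - r / 6 * G z a b) U := fun a b =>
    (hG.contDiffOn_ricci a b).sub (contDiffOn_const.mul (hg a b))
  refine ((hG.contDiffOn_riemann a b c d).sub (contDiffOn_const.mul
    (((((hg a c).mul (hP b d)).sub ((hg a d).mul (hP b c))).sub ((hg b c).mul (hP a d))).add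
      ((hg b d).mul (hP a c))))).congr fun z hz => weyl_eq (hr z hz) a b c d

lemma div_ricci_eq_zero (hy : y ∈ U) (c : Fin 4) :
    ∑ d, ∑ q, ginv G d q y * cov2 G (ricci G) q c d y = 0 := by
  have h := hG.div_ricci hy c
  rw [pd_congr hG.isOpen hr hy, pd_const] at h
  linarith

/-- The divergence of the Weyl tensor is half the Cotton tensor. -/
lemma div_weyl (hy : y ∈ U) (a c b : Fin 4) :
    ∑ d, ∑ q, ginv G d q y * cov4 G (fun a b c d => weyl G ![a, b, c, d]) q a c b d y
      = (1 / 2 : ℝ) * (cov2 G (ricci G) c b a y - cov2 G (ricci G) a b c y) := by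
  have hP : ∀ a b, ContDiffOn ℝ ∞ (fun z => ricci G a b z - r / 6 * G z a b) U := fun a b =>
    (hG.contDiffOn_ricci a b).sub (contDiffOn_const.mul (hG.contDiffOn a b))
  have h1 : ∀ d q, cov4 G (fun a b c d => weyl G ![a, b, c, d]) q a c b d y
      = cov4 G (riemann G) q a c b d y - (1 / 2 : ℝ) * (G y a b * cov2 G (ricci G) q c d y
        - G y a d * cov2 G (ricci G) q c b y - G y c b * cov2 G (ricci G) q a d y
        + G y c d * cov2 G (ricci G) q a b y) := by
    intro d q
    rw [cov4_congr hG.isOpen (fun a b c d z hz => weyl_eq (hr z hz) a b c d) hy,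
      hG.cov4_sub_kulkarniNomizu hG.contDiffOn_riemann hP hy]
    simp only [hG.cov2_sub_metric hG.contDiffOn_ricci _ hy]
  have e1 : ∀ k c, ∑ d, ∑ q, ginv G d q y * (k * cov2 G (ricci G) q c d y) = 0 := by
    intro k c
    simp only [mul_left_comm _ k, ← Finset.mul_sum]
    rw [hG.div_ricci_eq_zero hr hy, mul_zero]
  have e2 := hG.contr_metric_mul hy (fun q => cov2 G (ricci G) q c b y) a
  have e3 := hG.contr_metric_mul hy (fun q => cov2 G (ricci G) q a b y) c
  simp only [h1, mul_sub, mul_add, mul_left_comm _ (1 / 2 : ℝ), Finset.sum_sub_distrib,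
    Finset.sum_add_distrib, ← Finset.mul_sum]
  rw [hG.div_riemann hy, e1, e1, e2, e3, hG.cov2_ricci_symm hy c a b, hG.cov2_ricci_symm hy a c b]
  ring

omit hr hG in
lemma double_contr_comm (A : Fin 4 → Fin 4 → ℝ) (X : Fin 4 → Fin 4 → Fin 4 → Fin 4 → ℝ) :
    ∑ c, ∑ d, ∑ p, ∑ q, A c p * A d q * X c d p q
      = ∑ c, ∑ p, A c p * ∑ d, ∑ q, A d q * X c d p q := by
  refine Finset.sum_congr rfl fun c _ => ?_
  rw [Finset.sum_comm]
  simp only [Finset.mul_sum, mul_assoc]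

/-- For constant scalar curvature, the second derivatives of the Weyl tensor in the Bach tensor are
second derivatives of the Ricci tensor. -/
lemma bach_eq (hy : y ∈ U) (a b : Fin 4) :
    bach G a b y = (1 / 2 : ℝ) * ∑ c, ∑ p, ginv G c p y *
        (cov3 G (cov2 G (ricci G)) p c b a y - cov3 G (cov2 G (ricci G)) p a b c y)
      + (1 / 2 : ℝ) * ∑ c, ∑ p, ginv G c p y * ∑ d, ∑ q, ginv G d q y *
        (ricci G p q y * weyl G ![a, c, b, d] y) := by
  have hU := hG.isOpen
  unfold bach
  rw [double_contr_comm (fun c p => ginv G c p y) (fun c d p q =>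
    covDeriv G (covDeriv G (weyl G)) ![p, q, a, c, b, d] y
      + (1 / 2 : ℝ) * ricci G p q y * weyl G ![a, c, b, d] y)]
  simp only [mul_add, Finset.sum_add_distrib]
  congr 1
  · simp only [Finset.mul_sum (a := (1 / 2 : ℝ))]
    refine Finset.sum_congr rfl fun c _ => Finset.sum_congr rfl fun p _ => ?_
    have h1 : ∀ d q, covDeriv G (covDeriv G (weyl G)) ![p, q, a, c, b, d] y
        = cov5 G (cov4 G (fun a b c d => weyl G ![a, b, c, d])) p q a c b d y := by
      intro d q
      rw [covDeriv_five]
      congr 1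
      funext q a b c d z
      exact covDeriv_four (weyl G) q a b c d
    simp only [h1]
    rw [hG.contr_cov5 (fun q a b c d => hG.contDiffOn_cov4 (hG.contDiffOn_weyl hr) q a b c d) hy,
      cov3_congr hU (fun a c b z hz => hG.div_weyl hr hz a c b) hy]
    have hc := hG.contDiffOn_cov2 hG.contDiffOn_ricci
    unfold cov3
    rw [pd_mul hU contDiffOn_const ((hc c b a).sub (hc a b c)) hy, pd_const,
      pd_sub hU (hc c b a) (hc a b c) hy]
    simp only [Fin.sum_univ_four]
    ring
  · simp only [Finset.mul_sum]
    refine Finset.sum_congr rfl fun c _ => Finset.sum_congr rfl fun p _ =>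
      Finset.sum_congr rfl fun d _ => Finset.sum_congr rfl fun q _ => ?_
    ring

/-- The Weyl tensor is trace-free. -/
lemma contr_weyl (hy : y ∈ U) (a b : Fin 4) :
    ∑ d, ∑ q, ginv G d q y * weyl G ![a, d, b, q] y = 0 := by
  have hRic : ∑ d, ∑ q, ginv G d q y * ricci G d q y = r := hr y hy
  have e1 := hG.contr_metric_mul hy (fun q => ricci G q b y) a
  have e2 := hG.contr_metric_mul hy (fun q => G y q b) a
  have e3 : ∑ d, ∑ q, ginv G d q y * (G y d b * ricci G a q y) = ricci G a b y := by
    have := hG.contr_metric_mul hy (fun d => ricci G a d y) b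
    rw [← this]
    refine Finset.sum_congr rfl fun d _ => Finset.sum_congr rfl fun q _ => ?_
    rw [hG.symm y hy b d]
  have e4 : ∑ d, ∑ q, ginv G d q y * (G y a q * ricci G d b y) = ricci G a b y := by
    rw [← e1, Finset.sum_comm]
    refine Finset.sum_congr rfl fun d _ => Finset.sum_congr rfl fun q _ => ?_
    rw [hG.ginv_symm hy]
  have e5 : ∑ d, ∑ q, ginv G d q y * (G y d b * G y a q) = G y a b := by
    rw [← e2]
    rw [Finset.sum_comm]
    refine Finset.sum_congr rfl fun d _ => Finset.sum_congr rfl fun q _ => ?_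
    rw [hG.ginv_symm hy]
    ring
  have e6 := hG.contr_metric hy
  have e7 := hG.contr_riemann hy a b
  have hW : ∀ d q, ginv G d q y * weyl G ![a, d, b, q] y
      = ginv G d q y * riemann G a d b q y
        - (1 / 2 : ℝ) * G y a b * (ginv G d q y * ricci G d q y)
        + (1 / 2 : ℝ) * (ginv G d q y * (G y a q * ricci G d b y))
        + (1 / 2 : ℝ) * (ginv G d q y * (G y d b * ricci G a q y))
        - ((1 / 2 : ℝ) * ricci G a b y - r / 6 * G y a b) * (ginv G d q y * G y d q)
        - r / 6 * (ginv G d q y * (G y d b * G y a q)) := by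
    intro d q
    rw [weyl_eq (hr y hy)]
    ring
  simp only [hW, Finset.sum_sub_distrib, Finset.sum_add_distrib, ← Finset.mul_sum]
  rw [e7, hRic, e3, e4, e5, e6]
  ring

/-- The derivatives of the scalar curvature drop out of the field equations when it is constant. -/
lemma fieldEq_eq (hy : y ∈ U) (α' β' γ' Λ : ℝ) (a b : Fin 4) :
    fieldEq α' β' γ' Λ G a b y
      = γ' * (ricci G a b y - (1 / 2 : ℝ) * r * G y a b + Λ * G y a b) - 4 * α' * bach G a b y
        + 2 * β' * ((ricci G a b y - (1 / 4 : ℝ) * r * G y a b) * r) := by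
  have hh : ∀ a b, hess G (scalarCurv G) a b y = 0 := by
    intro a b
    unfold hess
    rw [covDeriv_one, cov1_congr (w := fun _ _ => 0) hG.isOpen (fun a z hz => by
      rw [covDeriv_zero, pd_congr hG.isOpen hr hz, pd_const]) hy]
    simp [cov1, pd_const]
  have hb : box G (scalarCurv G) y = 0 := by simp [box, hh]
  unfold fieldEq
  rw [hh, hb, hr y hy]
  ring

end Bach

end IsMetricOn

/-! ### Null frames -/

section NullFrames

variable {g : Matrix (Fin 4) (Fin 4) ℝ} {F : Fin 4 → Fin 4 → ℝ}

/-- The inverse metric in terms of a null frame, `g⁻¹ = ℓ ⊗ n + n ⊗ ℓ + ∑ m⁽ⁱ⁾ ⊗ m⁽ⁱ⁾`. -/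
lemma IsNullFrame.inv_eq (hF : IsNullFrame g F) (a b : Fin 4) :
    g⁻¹ a b = F 0 a * F 1 b + F 1 a * F 0 b + F 2 a * F 2 b + F 3 a * F 3 b := by
  have h1 : Matrix.of F * (g * (Matrix.of F).transpose * nullGram) = 1 := by
    have h2 : Matrix.of F * g * (Matrix.of F).transpose = nullGram := by
      ext i j
      rw [← hF i j]
      simp only [Matrix.mul_apply, Finset.sum_mul, Matrix.of_apply, Matrix.transpose_apply]
      rw [Finset.sum_comm]
      refine Finset.sum_congr rfl fun a _ => Finset.sum_congr rfl fun b _ => ?_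
      ring
    rw [← Matrix.mul_assoc, ← Matrix.mul_assoc, h2]
    ext i j
    fin_cases i <;> fin_cases j <;> simp [nullGram, Matrix.mul_apply, Fin.sum_univ_four]
  have h3 := mul_eq_one_comm.mp h1
  rw [Matrix.mul_assoc, Matrix.mul_assoc, ← Matrix.mul_assoc (Matrix.of F).transpose] at h3
  rw [Matrix.inv_eq_right_inv h3]
  simp only [Matrix.mul_apply, Fin.sum_univ_four, Matrix.of_apply, Matrix.transpose_apply, nullGram]
  simp
  ring

lemma sum_pi_cons {n : ℕ} (f : (Fin (n + 1) → Fin 4) → ℝ) :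
    ∑ J, f J = ∑ a, ∑ J : Fin n → Fin 4, f (Fin.cons a J) := by
  rw [← (Fin.consEquiv fun _ : Fin (n + 1) => Fin 4).sum_comp, Fintype.sum_prod_type]
  rfl

lemma frameComp_four (T : TensorField 4) (F : Fin 4 → Fin 4 → ℝ) (y : E4) (i j k m : Fin 4) :
    frameComp T F y ![i, j, k, m]
      = ∑ a, ∑ b, ∑ c, ∑ d, T ![a, b, c, d] y * (F i a * F j b * F k c * F m d) := by
  unfold frameComp
  rw [sum_pi_cons]
  refine Finset.sum_congr rfl fun a _ => ?_
  rw [sum_pi_cons]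
  refine Finset.sum_congr rfl fun b _ => ?_
  rw [sum_pi_cons]
  refine Finset.sum_congr rfl fun c _ => ?_
  rw [sum_pi_cons]
  refine Finset.sum_congr rfl fun d _ => ?_
  rw [Fintype.sum_unique, Fin.prod_univ_four]
  have key : ∀ K : Fin 4 → Fin 4, K = ![a, b, c, d] →
      T K y * (F i (K 0) * F j (K 1) * F k (K 2) * F m (K 3))
        = T ![a, b, c, d] y * (F i a * F j b * F k c * F m d) := by
    rintro _ rfl
    rfl
  refine key _ ?_
  ext s
  fin_cases s <;> rfl

end NullFrames

/-! ### Products under multiple sums -/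

section Sums

variable (m : Fin 4 → ℝ)

lemma sum_contr_mul (x z : Fin 4 → ℝ) :
    ∑ a, ∑ b, m a * m b * (x b * z a) = (∑ b, x b * m b) * ∑ a, z a * m a := by
  rw [Finset.sum_mul_sum, Finset.sum_comm]
  refine Finset.sum_congr rfl fun b _ => Finset.sum_congr rfl fun a _ => ?_
  ring

lemma sum_mul_ac_bd (X Y : Fin 4 → Fin 4 → ℝ) :
    ∑ a, ∑ b, ∑ c, ∑ d, X a c * Y b d = (∑ a, ∑ c, X a c) * ∑ b, ∑ d, Y b d := by
  simp only [← Finset.mul_sum, ← Finset.sum_mul]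

lemma sum_mul_ad_bc (X Y : Fin 4 → Fin 4 → ℝ) :
    ∑ a, ∑ b, ∑ c, ∑ d, X a d * Y b c = (∑ a, ∑ c, X a c) * ∑ b, ∑ d, Y b d := by
  rw [← sum_mul_ac_bd]
  exact Finset.sum_congr rfl fun a _ => Finset.sum_congr rfl fun b _ => Finset.sum_comm

end Sums

/-- The covector `ℓ_a = g_{ab} ℓ^b`, with curried index. -/
def lowered (G : MetricField) (l : E4 → Fin 4 → ℝ) (a : Fin 4) (y : E4) : ℝ :=
  ∑ b, G y a b * l y b

/-- On the open set `U` of coordinates, `R_{ab} = Λ g_{ab} + φ ℓ_a ℓ_b` with a smooth nowhere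
vanishing null vector field `ℓ` and a nowhere vanishing function `φ`, whose regularity is not
prescribed. -/
structure HasNullRicciOn (U : Set E4) (G : MetricField) (Λ : ℝ) (φ : E4 → ℝ)
    (l : E4 → Fin 4 → ℝ) : Prop where
  contDiffOn (a : Fin 4) : ContDiffOn ℝ ∞ (fun z => l z a) U
  null (y : E4) (hy : y ∈ U) : ∑ a, lowered G l a y * l y a = 0
  exists_ne (y : E4) (hy : y ∈ U) : ∃ a, lowered G l a y ≠ 0
  ne_zero (y : E4) (hy : y ∈ U) : φ y ≠ 0
  ricci_eq (y : E4) (hy : y ∈ U) (a b : Fin 4) :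
    ricci G a b y = Λ * G y a b + φ y * lowered G l a y * lowered G l b y

namespace HasNullRicciOn

variable {U : Set E4} {G : MetricField} {Λ : ℝ} {φ : E4 → ℝ} {l : E4 → Fin 4 → ℝ} {y : E4}
  (hG : IsMetricOn U G) (hS : HasNullRicciOn U G Λ φ l)
include hG hS

/-! ### Geodesy -/

section Geodesy

lemma contDiffOn_lowered (a : Fin 4) : ContDiffOn ℝ ∞ (lowered G l a) U :=
  contDiffOn_sum fun b => (hG.contDiffOn a b).mul (hS.contDiffOn b)

/-- The factor `φ` is smooth because it is the quotient of a diagonal component of the smooth tensor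
`Ric - Λ g` by the square of a nonzero component of `ℓ`. -/
lemma contDiffOn_factor : ContDiffOn ℝ ∞ φ U := by
  intro y hy
  obtain ⟨a, ha⟩ := hS.exists_ne y hy
  have hL := (hS.contDiffOn_lowered hG a).contDiffAt (hG.isOpen.mem_nhds hy)
  have h1 : ContDiffAt ℝ ∞ (fun z => (ricci G a a z - Λ * G z a a)
      / (lowered G l a z * lowered G l a z)) y :=
    ((((hG.contDiffOn_ricci a a).sub (contDiffOn_const.mul (hG.contDiffOn a a))).contDiffAt
      (hG.isOpen.mem_nhds hy)).div (hL.mul hL) (mul_ne_zero ha ha))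
  refine (h1.congr_of_eventuallyEq ?_).contDiffWithinAt
  filter_upwards [hG.isOpen.mem_nhds hy, hL.continuousAt.eventually_ne ha] with z hz hz'
  rw [hS.ricci_eq z hz]
  field_simp
  ring

omit hS in
lemma sum_ginv_mul_lowered (hy : y ∈ U) (a : Fin 4) :
    ∑ b, ginv G a b y * lowered G l b y = l y a := by
  have h := sum_mul_sum_assoc (fun b => ginv G a b y) (fun b e => G y b e) (l y)
  unfold lowered
  rw [← h]
  simp [hG.sum_ginv_mul hy]

omit hS in
lemma contr_lowered_mul (hy : y ∈ U) (X : Fin 4 → ℝ) :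
    ∑ d, ∑ q, ginv G d q y * (lowered G l d y * X q) = ∑ q, l y q * X q := by
  rw [Finset.sum_comm]
  refine Finset.sum_congr rfl fun q _ => ?_
  rw [← sum_ginv_mul_lowered (l := l) hG hy q, Finset.sum_mul]
  exact Finset.sum_congr rfl fun d _ => by rw [hG.ginv_symm hy]; ring

lemma scalarCurv_eq (hy : y ∈ U) : scalarCurv G y = 4 * Λ := by
  have h1 := hG.contr_metric hy
  have h2 := contr_lowered_mul (l := l) hG hy (fun q => lowered G l q y)
  have h3 : ∑ q, l y q * lowered G l q y = 0 := by
    rw [← hS.null y hy]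
    exact Finset.sum_congr rfl fun q _ => mul_comm _ _
  have h4 : ∀ a b, ginv G a b y * ricci G a b y = Λ * (ginv G a b y * G y a b)
      + φ y * (ginv G a b y * (lowered G l a y * lowered G l b y)) := by
    intro a b
    rw [hS.ricci_eq y hy]
    ring
  unfold scalarCurv
  simp only [h4, Finset.sum_add_distrib, ← Finset.mul_sum]
  rw [h1, h2, h3]
  ring

lemma contDiffOn_smul_lowered (a : Fin 4) :
    ContDiffOn ℝ ∞ (fun z => φ z * lowered G l a z) U :=
  (hS.contDiffOn_factor hG).mul (hS.contDiffOn_lowered hG a)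

lemma cov2_ricci (hy : y ∈ U) (c a b : Fin 4) :
    cov2 G (ricci G) c a b y
      = cov2 G (fun a b z => (φ z * lowered G l a z) * lowered G l b z) c a b y := by
  rw [← hG.cov2_sub_metric (r := -Λ) (fun a b => (hS.contDiffOn_smul_lowered hG a).mul
    (hS.contDiffOn_lowered hG b)) hy]
  refine cov2_congr hG.isOpen (fun a b z hz => ?_) hy c a b
  rw [hS.ricci_eq z hz]
  ring

/-- Since the divergence of `φ ℓ_a ℓ_b` vanishes, `ℓ` is geodetic. -/
lemma geodetic (hy : y ∈ U) :
    ∃ c : ℝ, ∀ a, ∑ b, l y b * cov1 G (lowered G l) b a y = c * lowered G l a y := by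
  refine ⟨- (∑ d, ∑ q, ginv G d q y * cov1 G (fun a z => φ z * lowered G l a z) q d y) / φ y,
    fun a => ?_⟩
  have h := hG.div_ricci_eq_zero (fun z hz => hS.scalarCurv_eq hG hz) hy a
  have h1 : ∀ q d, cov2 G (ricci G) q a d y
      = cov1 G (fun a z => φ z * lowered G l a z) q d y * lowered G l a y
        + φ y * (lowered G l d y * cov1 G (lowered G l) q a y) := by
    intro q d
    rw [hG.cov2_ricci_symm hy, hS.cov2_ricci hG hy, hG.cov2_mul (hS.contDiffOn_smul_lowered hG)
      (hS.contDiffOn_lowered hG) hy]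
    ring
  simp only [h1, mul_add, Finset.sum_add_distrib, mul_left_comm _ (φ y), ← mul_assoc,
    ← Finset.sum_mul] at h
  simp only [mul_assoc, ← Finset.mul_sum] at h
  rw [contr_lowered_mul hG hy (fun q => cov1 G (lowered G l) q a y)] at h
  have hφ := hS.ne_zero y hy
  field_simp
  linarith

end Geodesy

/-! ### The field equations along the transverse directions -/

section Transverse

variable {m : Fin 4 → ℝ}

/-- If `m` is orthogonal to `ℓ`, then only products of first derivatives of `ℓ` contribute to
the `mm`-component of the second derivatives of `φ ℓ ℓ`. -/
lemma transverse_hessian (hy : y ∈ U) (hm : ∑ a, lowered G l a y * m a = 0) (p c : Fin 4) :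
    ∑ a, ∑ b, m a * m b * cov3 G
        (cov2 G (fun a b z => (φ z * lowered G l a z) * lowered G l b z)) p c b a y
      = 2 * φ y * ((∑ b, cov1 G (lowered G l) c b y * m b)
        * ∑ b, cov1 G (lowered G l) p b y * m b) := by
  have hL := hS.contDiffOn_lowered hG
  have hu := hS.contDiffOn_smul_lowered hG
  have hA := hG.contDiffOn_cov1 hu
  have hB := hG.contDiffOn_cov1 hL
  set L := lowered G l
  set u : Fin 4 → E4 → ℝ := fun a z => φ z * L a z
  have h1 : ∀ a b, cov3 G (cov2 G (fun a b z => u a z * L b z)) p c b a y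
      = cov2 G (cov1 G u) p c b y * L a y + cov1 G u c b y * cov1 G L p a y
        + (cov1 G u p b y * cov1 G L c a y + u b y * cov2 G (cov1 G L) p c a y) := by
    intro a b
    rw [cov3_congr hG.isOpen (fun c b a z hz => hG.cov2_mul hu hL hz c b a) hy,
      IsMetricOn.cov3_add hG.isOpen (fun c b a => (hA c b).mul (hL a))
        (fun c b a => (hu b).mul (hB c a)) hy,
      hG.cov3_mul_covector hA hL hy, hG.cov3_covector_mul hB hu hy]
  have h2 : ∀ c, ∑ b, cov1 G u c b y * m b = φ y * ∑ b, cov1 G L c b y * m b := by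
    intro c
    have : ∀ b, cov1 G u c b y * m b
        = pd c φ y * (L b y * m b) + φ y * (cov1 G L c b y * m b) := by
      intro b
      rw [hG.cov1_smul (hS.contDiffOn_factor hG) hL hy]
      ring
    simp only [this, Finset.sum_add_distrib, ← Finset.mul_sum]
    rw [hm]
    ring
  have h3 : ∑ b, u b y * m b = 0 := by
    simp only [u, mul_assoc, ← Finset.mul_sum]
    rw [hm, mul_zero]
  change ∑ a, ∑ b, m a * m b * cov3 G (cov2 G (fun a b z => u a z * L b z)) p c b a y = _
  simp only [h1, mul_add, Finset.sum_add_distrib]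
  rw [sum_contr_mul m (fun b => cov2 G (cov1 G u) p c b y) (fun a => L a y),
    sum_contr_mul m (fun b => cov1 G u c b y) (fun a => cov1 G L p a y),
    sum_contr_mul m (fun b => cov1 G u p b y) (fun a => cov1 G L c a y),
    sum_contr_mul m (fun b => u b y) (fun a => cov2 G (cov1 G L) p c a y), hm, h3, h2, h2]
  ring

/-- The component `R(ℓ, m, ℓ, m)` vanishes when the Weyl component `C(ℓ, m, ℓ, m)` does. -/
lemma riemann_null (hy : y ∈ U) (hm : ∑ a, lowered G l a y * m a = 0)
    (hW : ∑ a, ∑ b, ∑ c, ∑ d, weyl G ![a, b, c, d] y * (l y a * m b * l y c * m d) = 0) :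
    ∑ a, ∑ b, ∑ c, ∑ d, riemann G a b c d y * (l y a * m b * l y c * m d) = 0 := by
  set P : Fin 4 → Fin 4 → ℝ := fun a b => ricci G a b y - 4 * Λ / 6 * G y a b
  have hll : ∑ a, ∑ c, G y a c * l y a * l y c = 0 := by
    rw [← hS.null y hy]
    refine Finset.sum_congr rfl fun a _ => ?_
    rw [lowered, Finset.sum_mul]
    exact Finset.sum_congr rfl fun c _ => by ring
  have hlm : ∑ a, ∑ d, G y a d * l y a * m d = 0 := by
    rw [← hm, Finset.sum_comm]
    refine Finset.sum_congr rfl fun d _ => ?_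
    rw [lowered, Finset.sum_mul]
    exact Finset.sum_congr rfl fun a _ => by rw [hG.symm y hy d a]
  have hml : ∑ b, ∑ c, G y b c * m b * l y c = 0 := by
    rw [← hlm, Finset.sum_comm]
    refine Finset.sum_congr rfl fun d _ => Finset.sum_congr rfl fun a _ => ?_
    rw [hG.symm y hy d a]
    ring
  have hP : ∑ a, ∑ c, P a c * l y a * l y c = 0 := by
    have h1 : ∀ a c, P a c * l y a * l y c = (Λ / 3) * (G y a c * l y a * l y c)
        + φ y * ((lowered G l a y * l y a) * (lowered G l c y * l y c)) := by
      intro a c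
      simp only [P]
      rw [hS.ricci_eq y hy]
      ring
    simp only [h1, Finset.sum_add_distrib, ← Finset.mul_sum, ← Finset.sum_mul]
    rw [hll, hS.null y hy]
    ring
  have hR : ∀ a b c d, riemann G a b c d y * (l y a * m b * l y c * m d)
      = weyl G ![a, b, c, d] y * (l y a * m b * l y c * m d) + (1 / 2 : ℝ) *
        ((G y a c * l y a * l y c) * (P b d * m b * m d)
          - (G y a d * l y a * m d) * (P b c * m b * l y c)
          - (P a d * l y a * m d) * (G y b c * m b * l y c)
          + (P a c * l y a * l y c) * (G y b d * m b * m d)) := by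
    intro a b c d
    rw [IsMetricOn.weyl_eq (hS.scalarCurv_eq hG hy)]
    simp only [P]
    ring
  simp only [hR, Finset.sum_add_distrib, Finset.sum_sub_distrib, ← Finset.mul_sum
    (a := (1 / 2 : ℝ))]
  rw [hW, sum_mul_ac_bd (fun a c => G y a c * l y a * l y c) (fun b d => P b d * m b * m d),
    sum_mul_ad_bc (fun a d => G y a d * l y a * m d) (fun b c => P b c * m b * l y c),
    sum_mul_ad_bc (fun a d => P a d * l y a * m d) (fun b c => G y b c * m b * l y c),
    sum_mul_ac_bd (fun a c => P a c * l y a * l y c) (fun b d => G y b d * m b * m d),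
    hll, hlm, hml, hP]
  ring

/-- The commuted second derivatives `∇^c ∇_a (φ ℓ_b ℓ_c)` have no `mm`-component. -/
lemma transverse_commuted (hy : y ∈ U) (hm : ∑ a, lowered G l a y * m a = 0)
    (hW : ∑ a, ∑ b, ∑ c, ∑ d, weyl G ![a, b, c, d] y * (l y a * m b * l y c * m d) = 0) :
    ∑ a, ∑ b, m a * m b * ∑ c, ∑ p, ginv G c p y * cov3 G
        (cov2 G (fun a b z => (φ z * lowered G l a z) * lowered G l b z)) p a b c y = 0 := by
  have hL := hS.contDiffOn_lowered hG
  have hu := hS.contDiffOn_smul_lowered hG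
  have hR := hS.riemann_null hG hy hm hW
  have hSs : ∀ a b, ContDiffOn ℝ ∞
      ((fun a b z => (φ z * lowered G l a z) * lowered G l b z :
        Fin 4 → Fin 4 → E4 → ℝ) a b) U := fun a b => (hu a).mul (hL b)
  -- Interchanging the two derivatives produces the derivative of the divergence, which vanishes on
  -- all of `U`, and two curvature terms.
  have hdiv : ∀ z ∈ U, ∀ b, ∑ d, ∑ q, ginv G d q z *
      cov2 G (fun a b z => (φ z * lowered G l a z) * lowered G l b z) q b d z = 0 := by
    intro z hz b
    simp only [← hS.cov2_ricci hG hz]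
    exact hG.div_ricci_eq_zero (fun z hz => hS.scalarCurv_eq hG hz) hz b
  set S : Fin 4 → Fin 4 → E4 → ℝ := fun a b z => (φ z * lowered G l a z) * lowered G l b z with hSdef
  have h1 : ∀ a b, ∑ c, ∑ p, ginv G c p y * cov3 G (cov2 G S) a p b c y = 0 := by
    intro a b
    rw [hG.contr_cov3 (hG.contDiffOn_cov2 hSs) hy,
      cov1_congr (w := fun _ _ => 0) hG.isOpen (fun b z hz => hdiv z hz b) hy]
    simp [cov1, pd_const]
  have h2 : ∀ a b, ∑ c, ∑ p, ginv G c p y * cov3 G (cov2 G S) p a b c y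
      = ∑ c, ∑ p, ginv G c p y * (- (φ y * lowered G l c y
          * ∑ e, lowered G l e y * riemannUp G e b p a y)
        - (φ y * lowered G l b y) * ∑ e, riemannUp G e c p a y * lowered G l e y) := by
    intro a b
    rw [← sub_zero (∑ c, ∑ p, ginv G c p y * cov3 G (cov2 G S) p a b c y), ← h1 a b,
      ← Finset.sum_sub_distrib]
    refine Finset.sum_congr rfl fun c _ => ?_
    rw [← Finset.sum_sub_distrib]
    refine Finset.sum_congr rfl fun p _ => ?_
    rw [← mul_sub, hG.ricci_identity hSs hy]
    simp only [hSdef, Finset.mul_sum]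
    congr 1
    congr 1
    · rw [← Finset.sum_neg_distrib, ← Finset.sum_neg_distrib]
      exact Finset.sum_congr rfl fun e _ => by ring
    · exact Finset.sum_congr rfl fun e _ => by ring
  have h3 : ∀ b p a, ∑ e, lowered G l e y * riemannUp G e b p a y
      = ∑ f, l y f * riemann G f b p a y := by
    intro b p a
    unfold lowered riemann
    simp only [Finset.mul_sum, Finset.sum_mul]
    rw [Finset.sum_comm]
    refine Finset.sum_congr rfl fun f _ => Finset.sum_congr rfl fun e _ => ?_
    rw [hG.symm y hy e f]
    ring
  simp only [h2, h3]
  rw [IsMetricOn.contr_contr_comm (fun a b => m a * m b) (fun c p => ginv G c p y)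
    (fun a b c p => - (φ y * lowered G l c y * ∑ f, l y f * riemann G f b p a y)
        - (φ y * lowered G l b y) * ∑ e, riemannUp G e c p a y * lowered G l e y)]
  have h4 : ∀ c p, ∑ a, ∑ b, m a * m b * (- (φ y * lowered G l c y
          * ∑ f, l y f * riemann G f b p a y)
        - (φ y * lowered G l b y) * ∑ e, riemannUp G e c p a y * lowered G l e y)
      = lowered G l c y *
        (- φ y * ∑ a, ∑ b, m a * m b * ∑ f, l y f * riemann G f b p a y) := by
    intro c p
    have h5 := sum_contr_mul m (fun b => φ y * lowered G l b y)
      (fun a => ∑ e, riemannUp G e c p a y * lowered G l e y)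
    have h6 : ∑ b, φ y * lowered G l b y * m b = 0 := by
      simp only [mul_assoc, ← Finset.mul_sum]
      rw [hm, mul_zero]
    simp only [mul_sub, Finset.sum_sub_distrib]
    rw [h5, h6, zero_mul, sub_zero]
    simp only [Finset.mul_sum (s := Finset.univ) (a := -φ y), Finset.mul_sum
      (s := Finset.univ) (a := lowered G l c y)]
    refine Finset.sum_congr rfl fun a _ => Finset.sum_congr rfl fun b _ => ?_
    ring
  simp only [h4]
  rw [contr_lowered_mul hG hy
    (fun p => - φ y * ∑ a, ∑ b, m a * m b * ∑ f, l y f * riemann G f b p a y)]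
  have h7 : ∑ q, l y q * (- φ y * ∑ a, ∑ b, m a * m b * ∑ f, l y f * riemann G f b q a y)
      = - φ y * ∑ a, ∑ b, ∑ c, ∑ d, riemann G a b c d y * (l y a * m b * l y c * m d) := by
    have h8 : ∑ a, ∑ b, ∑ c, ∑ d, riemann G a b c d y * (l y a * m b * l y c * m d)
        = ∑ c, ∑ d, ∑ b, ∑ a, riemann G a b c d y * (l y a * m b * l y c * m d) := by
      rw [Finset.sum_comm]
      have e1 : ∀ b, ∑ a, ∑ c, ∑ d, riemann G a b c d y * (l y a * m b * l y c * m d)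
          = ∑ c, ∑ a, ∑ d, riemann G a b c d y * (l y a * m b * l y c * m d) :=
        fun b => Finset.sum_comm
      have e2 : ∀ b c, ∑ a, ∑ d, riemann G a b c d y * (l y a * m b * l y c * m d)
          = ∑ d, ∑ a, riemann G a b c d y * (l y a * m b * l y c * m d) :=
        fun b c => Finset.sum_comm
      simp only [e1, e2]
      rw [Finset.sum_comm]
      exact Finset.sum_congr rfl fun c _ => Finset.sum_comm
    rw [h8]
    simp only [Finset.mul_sum]
    refine Finset.sum_congr rfl fun c _ => Finset.sum_congr rfl fun d _ =>
      Finset.sum_congr rfl fun b _ => Finset.sum_congr rfl fun a _ => ?_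
    ring
  rw [h7, hR, mul_zero]

/-- The term `R^{cd} C_{acbd}` of the Bach tensor has no `mm`-component. -/
lemma transverse_ricci_weyl (hy : y ∈ U)
    (hW : ∑ a, ∑ b, ∑ c, ∑ d, weyl G ![a, b, c, d] y * (m a * l y b * m c * l y d) = 0) :
    ∑ a, ∑ b, m a * m b * ∑ c, ∑ p, ginv G c p y * ∑ d, ∑ q, ginv G d q y *
        (ricci G p q y * weyl G ![a, c, b, d] y) = 0 := by
  have hV : ∀ p d, ∑ q, ginv G d q y * ricci G p q y
      = Λ * (if p = d then 1 else 0) + φ y * (lowered G l p y * l y d) := by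
    intro p d
    rw [← hG.sum_mul_ginv hy p d, ← sum_ginv_mul_lowered (l := l) hG hy d]
    simp only [Finset.mul_sum, ← Finset.sum_add_distrib]
    refine Finset.sum_congr rfl fun q _ => ?_
    rw [hS.ricci_eq y hy, hG.ginv_symm hy d q]
    ring
  have h1 : ∀ a b p c, ∑ d, ∑ q, ginv G d q y * (ricci G p q y * weyl G ![a, c, b, d] y)
      = Λ * weyl G ![a, c, b, p] y
        + lowered G l p y * (φ y * ∑ d, l y d * weyl G ![a, c, b, d] y) := by
    intro a b p c
    simp only [← mul_assoc, ← Finset.sum_mul, hV]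
    simp only [add_mul, Finset.sum_add_distrib, mul_assoc, ← Finset.mul_sum]
    simp
    ring
  have h2 : ∀ a b, ∑ c, ∑ p, ginv G c p y * ∑ d, ∑ q, ginv G d q y *
        (ricci G p q y * weyl G ![a, c, b, d] y)
      = φ y * ∑ c, ∑ d, weyl G ![a, c, b, d] y * (l y c * l y d) := by
    intro a b
    have h3 : ∀ c, ∑ p, ginv G c p y * (lowered G l p y *
          (φ y * ∑ d, l y d * weyl G ![a, c, b, d] y))
        = l y c * (φ y * ∑ d, l y d * weyl G ![a, c, b, d] y) := by
      intro c
      rw [← sum_ginv_mul_lowered (l := l) hG hy c, Finset.sum_mul]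
      exact Finset.sum_congr rfl fun p _ => by ring
    simp only [h1, mul_add, Finset.sum_add_distrib, h3, mul_left_comm _ Λ, ← Finset.mul_sum]
    rw [hG.contr_weyl (fun z hz => hS.scalarCurv_eq hG hz) hy, mul_zero, zero_add]
    simp only [Finset.mul_sum]
    refine Finset.sum_congr rfl fun c _ => Finset.sum_congr rfl fun d _ => ?_
    ring
  simp only [h2]
  have h4 : ∑ a, ∑ b, m a * m b * (φ y * ∑ c, ∑ d, weyl G ![a, c, b, d] y * (l y c * l y d))
      = φ y * ∑ a, ∑ b, ∑ c, ∑ d, weyl G ![a, b, c, d] y * (m a * l y b * m c * l y d) := by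
    simp only [Finset.mul_sum]
    refine Finset.sum_congr rfl fun a _ => ?_
    rw [Finset.sum_comm]
    refine Finset.sum_congr rfl fun b _ => Finset.sum_congr rfl fun c _ =>
      Finset.sum_congr rfl fun d _ => ?_
    ring
  rw [h4, hW, mul_zero]

/-- The `mm`-component of the Bach tensor, for `m` orthogonal to `ℓ`. -/
lemma transverse_bach (hy : y ∈ U) (hm : ∑ a, lowered G l a y * m a = 0)
    (hW : ∑ a, ∑ b, ∑ c, ∑ d, weyl G ![a, b, c, d] y * (l y a * m b * l y c * m d) = 0)
    (hW' : ∑ a, ∑ b, ∑ c, ∑ d, weyl G ![a, b, c, d] y * (m a * l y b * m c * l y d) = 0) :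
    ∑ a, ∑ b, m a * m b * bach G a b y
      = φ y * ∑ c, ∑ p, ginv G c p y * ((∑ b, cov1 G (lowered G l) c b y * m b)
        * ∑ b, cov1 G (lowered G l) p b y * m b) := by
  have h1 := hS.transverse_commuted hG hy hm hW
  have h2 := hS.transverse_ricci_weyl hG hy hW'
  have h3 := fun p c => hS.transverse_hessian hG hy hm p c
  have hc : ∀ p a b c, cov3 G (cov2 G (ricci G)) p a b c y = cov3 G
      (cov2 G (fun a b z => (φ z * lowered G l a z) * lowered G l b z)) p a b c y :=
    fun p a b c => cov3_congr hG.isOpen (fun a b c z hz => hS.cov2_ricci hG hz a b c) hy p a b c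
  have hb : ∀ a b, m a * m b * bach G a b y
      = (1 / 2 : ℝ) * (m a * m b * ∑ c, ∑ p, ginv G c p y * cov3 G (cov2 G
          (fun a b z => (φ z * lowered G l a z) * lowered G l b z)) p c b a y)
        - (1 / 2 : ℝ) * (m a * m b * ∑ c, ∑ p, ginv G c p y * cov3 G (cov2 G
          (fun a b z => (φ z * lowered G l a z) * lowered G l b z)) p a b c y)
        + (1 / 2 : ℝ) * (m a * m b * ∑ c, ∑ p, ginv G c p y * ∑ d, ∑ q, ginv G d q y *
        (ricci G p q y * weyl G ![a, c, b, d] y)) := by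
    intro a b
    rw [hG.bach_eq (fun z hz => hS.scalarCurv_eq hG hz) hy]
    simp only [hc, mul_sub, Finset.sum_sub_distrib]
    ring
  simp only [hb, Finset.sum_add_distrib, Finset.sum_sub_distrib, ← Finset.mul_sum
    (a := (1 / 2 : ℝ))]
  rw [h1, h2, IsMetricOn.contr_contr_comm (fun a b => m a * m b) (fun c p => ginv G c p y)
    (fun a b c p => cov3 G (cov2 G
          (fun a b z => (φ z * lowered G l a z) * lowered G l b z)) p c b a y)]
  simp only [h3, Finset.mul_sum (s := Finset.univ) (a := φ y)]
  simp only [mul_zero, sub_zero, add_zero, Finset.mul_sum (a := (1 / 2 : ℝ))]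
  refine Finset.sum_congr rfl fun c _ => Finset.sum_congr rfl fun p _ => ?_
  ring

lemma fieldEq_eq (hy : y ∈ U) (α' β' γ' : ℝ) (a b : Fin 4) :
    fieldEq α' β' γ' Λ G a b y
      = (γ' + 8 * β' * Λ) * φ y * lowered G l a y * lowered G l b y - 4 * α' * bach G a b y := by
  rw [hG.fieldEq_eq (fun z hz => hS.scalarCurv_eq hG hz) hy, hS.ricci_eq y hy]
  ring

/-- Under the field equations the optical matrix of an aligned null field vanishes. -/
lemma optical_eq_zero (hy : y ∈ U) {α' β' γ' : ℝ} (hcoupling : α' ≠ 0 ∨ γ' + 8 * β' * Λ ≠ 0)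
    (hvac : ∀ a b, fieldEq α' β' γ' Λ G a b y = 0) {F : Fin 4 → Fin 4 → ℝ}
    (hF : IsNullFrame (G y) F) (hF0 : F 0 = l y) (hW : BoostOrderLE (weyl G) F y 1)
    {i : Fin 4} (hi : i = 2 ∨ i = 3) :
    (∑ q, (∑ b, cov1 G (lowered G l) q b y * F i b) * F 2 q = 0) ∧
      ∑ q, (∑ b, cov1 G (lowered G l) q b y * F i b) * F 3 q = 0 := by
  have hα : α' ≠ 0 := by
    -- Without the Bach tensor the field equations read `(γ' + 8 β' Λ) φ ℓ_a ℓ_b = 0`.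
    rintro rfl
    have hκ : γ' + 8 * β' * Λ ≠ 0 := hcoupling.resolve_left (by simp)
    obtain ⟨a, ha⟩ := hS.exists_ne y hy
    have h := hvac a a
    rw [hS.fieldEq_eq hG hy] at h
    have hφ := hS.ne_zero y hy
    simp [hκ, ha, hφ] at h
  have hm : ∑ a, lowered G l a y * F i a = 0 := by
    have h := hF i 0
    have h0 : nullGram i 0 = 0 := by rcases hi with rfl | rfl <;> simp [nullGram]
    rw [h0, hF0] at h
    rw [← h]
    refine Finset.sum_congr rfl fun a _ => ?_
    rw [lowered, Finset.sum_mul]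
    exact Finset.sum_congr rfl fun b _ => by ring
  have hbw : boostWeight i = 0 := by rcases hi with rfl | rfl <;> rfl
  have hw0 : boostWeight 0 = 1 := rfl
  -- Two contractions with `ℓ` and none with `n`: these components have boost weight `2`.
  have hW1 := hW ![0, i, 0, i] (by simp [Fin.sum_univ_four, hbw, hw0])
  have hW2 := hW ![i, 0, i, 0] (by simp [Fin.sum_univ_four, hbw, hw0])
  rw [frameComp_four, hF0] at hW1 hW2
  have hB := hS.transverse_bach hG hy hm hW1 hW2
  have hB0 : ∑ a, ∑ b, F i a * F i b * bach G a b y = 0 := by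
    have h1 : ∀ a b, F i a * F i b * bach G a b y
        = (γ' + 8 * β' * Λ) * φ y / (4 * α') * (F i a * F i b *
          (lowered G l b y * lowered G l a y)) := by
      intro a b
      have h := hvac a b
      rw [hS.fieldEq_eq hG hy] at h
      field_simp
      linear_combination (- F i a * F i b) * h
    simp only [h1, ← Finset.mul_sum]
    rw [sum_contr_mul (F i) (fun b => lowered G l b y) (fun b => lowered G l b y), hm]
    ring
  set X : Fin 4 → ℝ := fun q => ∑ b, cov1 G (lowered G l) q b y * F i b
  -- `X` annihilates `ℓ`, since `ℓ` is geodetic and orthogonal to `m`.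
  have hX0 : ∑ q, X q * F 0 q = 0 := by
    obtain ⟨c, hc⟩ := hS.geodetic hG hy
    have h1 : ∑ q, X q * F 0 q
        = ∑ b, (∑ q, l y q * cov1 G (lowered G l) q b y) * F i b := by
      simp only [X, Finset.sum_mul]
      rw [Finset.sum_comm, hF0]
      refine Finset.sum_congr rfl fun b _ => Finset.sum_congr rfl fun q _ => ?_
      ring
    rw [h1]
    simp only [hc, mul_assoc, ← Finset.mul_sum]
    rw [hm, mul_zero]
  rw [hB0] at hB
  have hsum := (mul_eq_zero.mp hB.symm).resolve_left (hS.ne_zero y hy)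
  have hsq : ∑ c, ∑ p, ginv G c p y * (X c * X p)
      = 2 * ((∑ q, X q * F 0 q) * ∑ q, X q * F 1 q) + (∑ q, X q * F 2 q) ^ 2
        + (∑ q, X q * F 3 q) ^ 2 := by
    simp only [ginv, hF.inv_eq, Fin.sum_univ_four]
    ring
  change ∑ c, ∑ p, ginv G c p y * (X c * X p) = 0 at hsum
  rw [hsq, hX0] at hsum
  constructor
  · change ∑ q, X q * F 2 q = 0
    nlinarith [sq_nonneg (∑ q, X q * F 2 q), sq_nonneg (∑ q, X q * F 3 q)]
  · change ∑ q, X q * F 3 q = 0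
    nlinarith [sq_nonneg (∑ q, X q * F 2 q), sq_nonneg (∑ q, X q * F 3 q)]

end Transverse

end HasNullRicciOn

/-! ### Coordinate components -/

section Components

variable {M : Type*} [TopologicalSpace M] [ChartedSpace E4 M] [IsManifold (𝓡 4) ∞ M]
  {e : OpenPartialHomeomorph M E4} {y : E4}

/-- The coordinate vector fields are smooth along the inverse chart. -/
lemma contMDiffOn_coordVec (he : e ∈ atlas E4 M) (i : Fin 4) :
    ContMDiffOn 𝓘(ℝ, E4) (𝓡 4).tangent ∞
      (fun y => (⟨e.symm y, coordVec e y i⟩ : TangentBundle (𝓡 4) M)) e.target := by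
  have he' : e ∈ IsManifold.maximalAtlas (𝓡 4) ∞ M := IsManifold.subset_maximalAtlas he
  have h1 := contMDiffOn_symm_of_mem_maximalAtlas he'
  have h2 := h1.contMDiffOn_tangentMapWithin (m := ∞) (by simp) e.open_target.uniqueMDiffOn
  have h3 : ContMDiff 𝓘(ℝ, E4) (𝓡 4).tangent ∞
      (fun y : E4 => (⟨y, (EuclideanSpace.single i (1 : ℝ) : E4)⟩ : TangentBundle (𝓡 4) E4)) :=
    contMDiff_vectorSpace_iff_contDiff.mpr contDiff_const
  refine (h2.comp h3.contMDiffOn (fun y hy => hy)).congr fun y hy => ?_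
  simp only [Function.comp, tangentMapWithin, coordVec]
  rw [mfderivWithin_of_isOpen e.open_target hy]

omit [IsManifold (𝓡 4) ∞ M] in
lemma mfderiv_symm_eq_sum (v : E4) :
    (mfderiv (𝓡 4) (𝓡 4) e.symm y v : TangentSpace (𝓡 4) (e.symm y))
      = ∑ i, v i • coordVec e y i := by
  have h : v = ∑ i, v i • (EuclideanSpace.single i (1 : ℝ) : E4) := by
    ext j
    simp [Pi.single_apply]
  let D : E4 →L[ℝ] TangentSpace (𝓡 4) (e.symm y) := mfderiv (𝓡 4) (𝓡 4) e.symm y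
  calc D v = D (∑ i, v i • (EuclideanSpace.single i (1 : ℝ) : E4)) := congrArg D h
    _ = ∑ i, v i • D (EuclideanSpace.single i (1 : ℝ) : E4) := by
      rw [map_sum]
      exact Finset.sum_congr rfl fun i _ => map_smul D (v i) _

lemma LorentzianMetric.inner_sum (g : LorentzianMetric M) (u v : Fin 4 → ℝ) :
    g.inner (e.symm y) (∑ i, u i • coordVec e y i) (∑ j, v j • coordVec e y j)
      = ∑ i, ∑ j, g.comp e y i j * u i * v j := by
  simp only [map_sum, map_smul, sum_apply, smul_apply,
    smul_eq_mul, Finset.mul_sum]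
  rw [Finset.sum_comm]
  refine Finset.sum_congr rfl fun i _ => Finset.sum_congr rfl fun j _ => ?_
  change _ = g.inner (e.symm y) (coordVec e y i) (coordVec e y j) * u i * v j
  ring

lemma mfderiv_mfderiv_symm (he : e ∈ atlas E4 M) (hy : y ∈ e.target) (v : E4) :
    mfderiv (𝓡 4) (𝓡 4) e (e.symm y) (mfderiv (𝓡 4) (𝓡 4) e.symm y v) = v := by
  have := IsManifold.of_le (I := 𝓡 4) (M := M) (m := 1) (n := ∞) (by simp)
  have he' := mdifferentiable_of_mem_atlas (I := 𝓡 4) he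
  exact congrArg (fun f => f v) (he'.comp_symm_deriv hy)

/-- A vector field is the combination of the coordinate vectors with its components. -/
lemma eq_sum_vecComp (he : e ∈ atlas E4 M) (hy : y ∈ e.target)
    (l : ∀ x : M, TangentSpace (𝓡 4) x) :
    l (e.symm y) = ∑ i, vecComp l e y i • coordVec e y i := by
  have := IsManifold.of_le (I := 𝓡 4) (M := M) (m := 1) (n := ∞) (by simp)
  have he' := mdifferentiable_of_mem_atlas (I := 𝓡 4) he
  apply he'.mfderiv_injective (e.map_target hy)
  have h := mfderiv_symm_eq_sum (e := e) (y := y)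
    (show E4 from mfderiv (𝓡 4) (𝓡 4) e (e.symm y) (l (e.symm y)))
  exact (mfderiv_mfderiv_symm he hy _).symm.trans
    (congrArg (mfderiv (𝓡 4) (𝓡 4) e (e.symm y)) h)

/-- A Lorentzian scalar product is nondegenerate. -/
lemma LorentzianMetric.eq_zero_of_inner (g : LorentzianMetric M) {x : M}
    {w : TangentSpace (𝓡 4) x} (h : ∀ u, g.inner x u w = 0) : w = 0 := by
  obtain ⟨b, hb⟩ := g.signature x
  apply b.repr.injective
  ext k
  have h1 := h (b k)
  rw [← b.sum_repr w, map_sum] at h1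
  simp only [map_smul, hb, smul_eq_mul] at h1
  simp only [mul_ite, mul_zero, Finset.sum_ite_eq, Finset.mem_univ, if_true] at h1
  by_cases hk : k = 0 <;> simpa [hk] using h1

lemma isMetricOn_comp (g : LorentzianMetric M) (he : e ∈ atlas E4 M) :
    IsMetricOn e.target (g.comp e) where
  isOpen := e.open_target
  contDiffOn a b := by
    rw [← contMDiffOn_iff_contDiffOn]
    have he' : e ∈ IsManifold.maximalAtlas (𝓡 4) ∞ M := IsManifold.subset_maximalAtlas he
    have h1 := contMDiffOn_symm_of_mem_maximalAtlas he'
    have : ContMDiffOn 𝓘(ℝ, E4) ((𝓡 4).prod 𝓘(ℝ)) ∞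
        (fun y ↦ Bundle.TotalSpace.mk' ℝ (E := Bundle.Trivial M ℝ) (e.symm y)
          (g.inner (e.symm y) (coordVec e y a) (coordVec e y b))) e.target := by
      apply ContMDiffOn.clm_bundle_apply₂ (F₁ := E4) (F₂ := E4)
      · exact g.contMDiff.comp_contMDiffOn h1
      · exact contMDiffOn_coordVec he a
      · exact contMDiffOn_coordVec he b
    intro y hy
    have := this y hy
    simp only [Bundle.contMDiffWithinAt_totalSpace] at this
    exact this.2
  symm y hy a b := g.symm _ _ _
  det_ne y hy := by
    have := IsManifold.of_le (I := 𝓡 4) (M := M) (m := 1) (n := ∞) (by simp)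
    have he' := mdifferentiable_of_mem_atlas (I := 𝓡 4) he
    -- A kernel vector of the Gram matrix spans a direction orthogonal to the whole tangent space.
    intro hdet
    obtain ⟨v, hv, hv0⟩ := Matrix.exists_mulVec_eq_zero_iff.mpr hdet
    apply hv
    have hbij := he'.symm.mfderiv_bijective (x := y) hy
    have hw : mfderiv (𝓡 4) (𝓡 4) e.symm y (WithLp.toLp 2 v : E4) = 0 := by
      apply g.eq_zero_of_inner
      intro u
      obtain ⟨u', rfl⟩ := hbij.2 u
      have h1 := mfderiv_symm_eq_sum (e := e) (y := y) (WithLp.toLp 2 v)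
      have h2 := mfderiv_symm_eq_sum (e := e) (y := y) (show E4 from u')
      refine (congrArg₂ (fun p q => g.inner (e.symm y) p q) h2 h1).trans ?_
      refine (g.inner_sum _ _).trans (Finset.sum_eq_zero fun i _ => ?_)
      have h3 : ∑ j, g.comp e y i j * v j = 0 := congrFun hv0 i
      calc ∑ j, g.comp e y i j * (show E4 from u') i * v j
          = (show E4 from u') i * ∑ j, g.comp e y i j * v j := by
            rw [Finset.mul_sum]
            exact Finset.sum_congr rfl fun j _ => by ring
        _ = 0 := by rw [h3, mul_zero]
    have h0 := hbij.1 (hw.trans (map_zero _).symm)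
    have h1 : (WithLp.toLp 2 v : E4) = 0 := h0
    simpa using h1

lemma contDiffOn_vecComp (he : e ∈ atlas E4 M) {l : ∀ x : M, TangentSpace (𝓡 4) x}
    (hl : ContMDiff (𝓡 4) (𝓡 4).tangent ∞ (fun x => (⟨x, l x⟩ : TangentBundle (𝓡 4) M)))
    (i : Fin 4) : ContDiffOn ℝ ∞ (fun y => vecComp l e y i) e.target := by
  have he' : e ∈ IsManifold.maximalAtlas (𝓡 4) ∞ M := IsManifold.subset_maximalAtlas he
  have h1 := contMDiffOn_symm_of_mem_maximalAtlas he'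
  have h2 := (contMDiffOn_of_mem_maximalAtlas he').contMDiffOn_tangentMapWithin (m := ∞)
    (by simp) e.open_source.uniqueMDiffOn
  have h3 : ContMDiffOn 𝓘(ℝ, E4) (𝓡 4).tangent ∞
      (fun y : E4 => (⟨y, (show E4 from mfderiv (𝓡 4) (𝓡 4) e (e.symm y) (l (e.symm y)))⟩ :
        TangentBundle (𝓡 4) E4)) e.target := by
    refine (h2.comp (hl.comp_contMDiffOn h1) (fun y hy => e.map_target hy)).congr fun y hy => ?_
    simp only [Function.comp, tangentMapWithin]
    rw [mfderivWithin_of_isOpen e.open_source (e.map_target hy)]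
    have tb : ∀ (a b : E4), a = b → ∀ v : E4,
        (⟨a, v⟩ : TangentBundle (𝓡 4) E4) = ⟨b, v⟩ := by
      rintro a _ rfl v
      rfl
    exact tb _ _ (e.right_inv hy).symm _
  have h4 := contMDiffOn_vectorSpace_iff_contDiffOn.mp h3
  exact (contDiffOn_euclidean.mp h4) i

lemma sum_lowered_mul_vecComp (g : LorentzianMetric M) (he : e ∈ atlas E4 M) (hy : y ∈ e.target)
    (l k : ∀ x : M, TangentSpace (𝓡 4) x) :
    ∑ a, lowered (g.comp e) (vecComp l e) a y * vecComp k e y a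
      = g.inner (e.symm y) (k (e.symm y)) (l (e.symm y)) := by
  rw [eq_sum_vecComp he hy l, eq_sum_vecComp he hy k, g.inner_sum]
  refine Finset.sum_congr rfl fun a _ => ?_
  rw [lowered, Finset.sum_mul]
  exact Finset.sum_congr rfl fun b _ => by ring

lemma hasNullRicciOn (g : LorentzianMetric M) (he : e ∈ atlas E4 M) {Λ : ℝ}
    {l : ∀ x : M, TangentSpace (𝓡 4) x} (hl : IsNullField g l) {ω' : M → ℝ}
    (hω' : ∀ x, ω' x ≠ 0) (hRicci : HasRicciForm g l Λ ω') :
    HasNullRicciOn e.target (g.comp e) Λ (fun y => ω' (e.symm y)) (vecComp l e) where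
  contDiffOn a := contDiffOn_vecComp he hl.smooth a
  null y hy := by
    rw [sum_lowered_mul_vecComp g he hy]
    exact hl.null _
  exists_ne y hy := by
    by_contra! h
    apply hl.ne_zero (e.symm y)
    rw [eq_sum_vecComp he hy l]
    have hG := isMetricOn_comp g he
    have h0 : ∀ i, vecComp l e y i = 0 := fun i => by
      rw [← HasNullRicciOn.sum_ginv_mul_lowered (l := vecComp l e) hG hy i]
      simp [h]
    simp [h0]
  ne_zero y hy := hω' _
  ricci_eq y hy a b := hRicci e he y hy a b

/-- The congruence is geodetic already by the contracted Bianchi identity. -/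
lemma isGeodetic (g : LorentzianMetric M) {Λ : ℝ} {l : ∀ x : M, TangentSpace (𝓡 4) x}
    (hl : IsNullField g l) {ω' : M → ℝ} (hω' : ∀ x, ω' x ≠ 0) (hRicci : HasRicciForm g l Λ ω') :
    IsGeodetic g l := by
  intro e he y hy
  obtain ⟨c, hc⟩ := (hasNullRicciOn g he hl hω' hRicci).geodetic (isMetricOn_comp g he) hy
  refine ⟨c, fun a => ?_⟩
  simp only [covDeriv_one]
  exact hc a

lemma hasZeroOpticalMatrix (g : LorentzianMetric M) {α' β' γ' Λ : ℝ}
    (hcoupling : α' ≠ 0 ∨ γ' + 8 * β' * Λ ≠ 0) (hvac : IsVacuumSolution α' β' γ' Λ g)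
    {l : ∀ x : M, TangentSpace (𝓡 4) x} (hl : IsNullField g l) {ω' : M → ℝ}
    (hω' : ∀ x, ω' x ≠ 0) (hRicci : HasRicciForm g l Λ ω') (hWeyl : IsWeylAligned g l) :
    HasZeroOpticalMatrix g l := by
  intro e he y hy F hF hF0
  have hX := fun i (hi : i = 2 ∨ i = 3) =>
    (hasNullRicciOn g he hl hω' hRicci).optical_eq_zero (isMetricOn_comp g he) hy
      hcoupling (hvac e he y hy) hF hF0 (hWeyl e he y hy F hF hF0) hi
  have hρ : ∀ v w : Fin 4 → ℝ,
      ∑ a, ∑ b, covDeriv (g.comp e) (lower (g.comp e) (vecComp l e)) ![b, a] y * v a * w b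
        = ∑ q, (∑ b, cov1 (g.comp e) (lowered (g.comp e) (vecComp l e)) q b y * v b) * w q := by
    intro v w
    simp only [Finset.sum_mul, covDeriv_one]
    exact Finset.sum_comm
  ext i j
  unfold opticalMatrix
  rw [hρ]
  fin_cases i <;> fin_cases j
  · exact (hX 2 (Or.inl rfl)).1
  · exact (hX 2 (Or.inl rfl)).2
  · exact (hX 3 (Or.inr rfl)).1
  · exact (hX 3 (Or.inr rfl)).2

end Components

end QuadraticGravity

end

theorem proposition1 {M : Type*} [TopologicalSpace M]
    [ChartedSpace QuadraticGravity.E4 M] [IsManifold (𝓡 4) ∞ M]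
    (g : QuadraticGravity.LorentzianMetric M)
    (α' β' γ' Λ : ℝ) (hcoupling : α' ≠ 0 ∨ γ' + 8 * β' * Λ ≠ 0)
    (hvac : QuadraticGravity.IsVacuumSolution α' β' γ' Λ g)
    (l : ∀ x : M, TangentSpace (𝓡 4) x) (hl : QuadraticGravity.IsNullField g l)
    (ω' : M → ℝ) (hω' : ∀ x, ω' x ≠ 0)
    (hRicci : QuadraticGravity.HasRicciForm g l Λ ω')
    (hWeyl : QuadraticGravity.IsWeylAligned g l) :
    QuadraticGravity.IsGeodetic g l ∧ QuadraticGravity.HasZeroOpticalMatrix g l ∧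
      QuadraticGravity.IsKundt g := by
  have hgeo := QuadraticGravity.isGeodetic g hl hω' hRicci
  have hopt := QuadraticGravity.hasZeroOpticalMatrix g hcoupling hvac hl hω' hRicci hWeyl
  exact ⟨hgeo, hopt, l, hl, hgeo, hopt⟩
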